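/- **The problem.** An instance of hypergraph orientation under explorable uncertainty with predictions consists of a finite hypergraph $H=(V,E)$ with non-empty hyperedges, an open uncertainty interval $I_v=(L_v,U_v)$, $L_v<U_v$, for each $v\in V$, a predicted weight $\bar w_v\in I_v$, and a precise weight $w_v\in I_v$ that is unknown to the algorithm. A query of $v$ reveals $w_v$ and replaces $I_v$ by the trivial interval $[w_v]$, which has lower limit $w_v$. A hyperedge is *solved* if one of its vertices has minimum weight in it for all weight vectors consistent with the current intervals. A set $Q\subseteq V$ is *feasible* if querying $Q$ solves all hyperedges, and $|\mathrm{OPT}|$ is the minimum size of a feasible set. An algorithm queries vertices adaptively until the set of queried vertices is feasible. A randomized algorithm is a probability distribution over deterministic algorithms; it *achieves competitive ratio* $\rho$ (where $\rho$ may depend on the instance) if on every instance it always ends with a feasible query set and its expected number of queries is at most $\rho\cdot|\mathrm{OPT}|$ (so it makes no query if $|\mathrm{OPT}|=0$). The *hop distance* $k_h$ is the number of ordered pairs $(u,v)$ of distinct vertices such that $\bar w_v\le L_u<w_v$, $w_v\le L_u<\bar w_v$, $w_v<U_u\le\bar w_v$ or $\bar w_v<U_u\le w_v$. **Algorithm 1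 with integer parameter $g\ge 2$.** All notions refer to the current intervals. A vertex is *leftmost* in a set $S$ of vertices if it has minimum lower limit in $S$. A vertex $v$ is *known mandatory* if it is leftmost in a hyperedge $S$ that is not solved and $I_u\subseteq I_v$ for some $u\in S\setminus\{v\}$. A vertex is *prediction mandatory* if it belongs to every feasible query set of the current instance when the predictions of all vertices not queried yet are correct. Two distinct vertices form a *witness pair* if they lie in a common hyperedge that is not solved, their intervals intersect, and one of them is leftmost in that hyperedge. For unqueried $u\ne v$, $\bar w_u$ *enforces* $v$ if $\bar w_u\in I_v$ and $u,v$ lie in a hyperedge $S$ that is not solved, where $v$ is leftmost in $S$, or $u$ is leftmost in $S$ and $v$ is leftmost in $S\setminus\{u\}$. *Exhaust* means: while there is a known mandatory vertex, query one. The algorithm resolves its choices arbitrarily and works as follows. 1. Exhaust. 2. Repeat the following until there is no prediction mandatory vertex: (a) as long as there is a prediction mandatory vertex and fewer than $g-2$ of them have been queried in this step (a), query one of them and exhaust; (b) if there are distinct $u,v,w$ such that $\bar w_u$ enforces $v$ and $\{u,w\}$ is a witness pair, choose such $u,v,w$, query $u$ and $w$, and then query $v$ if the weight revealed by $u$ lies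 in $I_v$; otherwise, if there are $u,v$ such that $\bar w_u$ enforces $v$, query such a $v$; (c) exhaust. 3. Compute a minimum vertex cover of the graph on $V$ whose edges are the witness pairs, and query its vertices. 4. Exhaust, and stop. **Theorem.** For every real number $\gamma\ge 2$ there are a number $\xi$ with $0\le\xi\le\frac1{48}$ and, for each integer $g\ge2$, an implementation of Algorithm 1 with parameter $g$, such that the following randomized algorithm for hypergraph orientation under explorable uncertainty with predictions achieves competitive ratio $$\min\Bigl\{\Bigl(1+\frac1\gamma+\xi\Bigr)\Bigl(1+\frac{k_h}{|\mathrm{OPT}|}\Bigr),\ \gamma\Bigr\}:$$ it chooses $\lceil\gamma\rceil$ with probability $\gamma-\lfloor\gamma\rfloor$ and $\lfloor\gamma\rfloor$ otherwise, and then runs Algorithm 1 with the chosen integer as parameter. -/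

import Mathlib

open scoped ENNReal

universe u

noncomputable section

namespace HypOrient

open scoped Classical

/-- What is given to an algorithm for hypergraph orientation under uncertainty with predictions:
a hypergraph on the finite vertex set `V`, an open uncertainty interval `(L v, U v)` for each
vertex, and a predicted weight in that interval. The precise weights are not part of it. -/
structure Input (V : Type u) where
  edges : Finset (Finset V)
  edges_nonempty : ∀ S ∈ edges, S.Nonempty
  L : V → ℝ
  U : V → ℝ
  L_lt_U : ∀ v, L v < U v
  pred : V → ℝ
  pred_mem : ∀ v, pred v ∈ Set.Ioo (L v) (U v)

/-- `w` is an admissible vector of precise weights. -/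
def IsRealization {V : Type u} (I : Input V) (w : V → ℝ) : Prop :=
  ∀ v, w v ∈ Set.Ioo (I.L v) (I.U v)

/-! ### Current instances -/

/-- The information gathered so far: `some x` for a vertex whose query returned the precise
weight `x`, and `none` for a vertex that has not been queried. -/
abbrev Known (V : Type u) := V → Option ℝ

/-- The state of information before the first query. -/
def Known.initial (V : Type u) : Known V := fun _ => none

/-- The state after the query of `v` returned `x`. -/
def Known.update {V : Type u} (K : Known V) (v : V) (x : ℝ) : Known V :=
  fun z => if z = v then some x else K z

/-- The state after all vertices of `Q` have been queried, the precise weights being `w`. -/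
def Known.reveal {V : Type u} (K : Known V) (w : V → ℝ) (Q : Finset V) : Known V :=
  fun z => if z ∈ Q then some (w z) else K z

/-- The current uncertainty interval of `v`: `(L v, U v)` as long as `v` has not been queried
(non-trivial), and `{w v}` afterwards (trivial). -/
def ival {V : Type u} (I : Input V) (K : Known V) (v : V) : Set ℝ :=
  match K v with
  | none => Set.Ioo (I.L v) (I.U v)
  | some x => {x}

/-- The lower limit of the current uncertainty interval of `v`. -/
def lowerLimit {V : Type u} (I : Input V) (K : Known V) (v : V) : ℝ := (K v).getD (I.L v)

/-- The orientation of `S` is known: some vertex of `S` has minimum weight in `S` for all weight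
vectors that are consistent with the current uncertainty intervals. -/
def Solved {V : Type u} (I : Input V) (K : Known V) (S : Finset V) : Prop :=
  ∃ v ∈ S, ∀ w' : V → ℝ, (∀ z, w' z ∈ ival I K z) → ∀ z ∈ S, w' v ≤ w' z

/-- `Q` is a feasible query set for the current instance when the precise weights are `w`. -/
def FeasibleFrom {V : Type u} (I : Input V) (K : Known V) (w : V → ℝ) (Q : Finset V) : Prop :=
  ∀ S ∈ I.edges, Solved I (K.reveal w Q) S

/-- `Q` is a feasible query set for the precise weights `w`. -/
def Feasible {V : Type u} (I : Input V) (w : V → ℝ) (Q : Finset V) : Prop :=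
  FeasibleFrom I (Known.initial V) w Q

/-- `|OPT|`, the minimum size of a feasible query set. -/
def optCard {V : Type u} (I : Input V) (w : V → ℝ) : ℕ :=
  sInf {n | ∃ Q : Finset V, Feasible I w Q ∧ Q.card = n}

/-! ### Hop distance -/

/-- The weight of `v` and its prediction lie in different positions relative to the interval of
`z`, that is, `k_z(v) = 1`. -/
def Hops {V : Type u} (I : Input V) (w : V → ℝ) (z v : V) : Prop :=
  (I.pred v ≤ I.L z ∧ I.L z < w v) ∨ (w v ≤ I.L z ∧ I.L z < I.pred v) ∨
  (w v < I.U z ∧ I.U z ≤ I.pred v) ∨ (I.pred v < I.U z ∧ I.U z ≤ w v)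

/-- The hop distance `k_h`. -/
def hopDistance {V : Type u} [Fintype V] (I : Input V) (w : V → ℝ) : ℕ :=
  ∑ v : V, ∑ z ∈ Finset.univ.erase v, if Hops I w z v then 1 else 0

/-! ### Adaptive deterministic and randomized algorithms -/

/-- An adaptive query strategy: either stop, or query a vertex and continue depending on the
precise weight that the query reveals. -/
inductive QueryTree (V : Type u) : Type u
  | halt : QueryTree V
  | query (v : V) (next : ℝ → QueryTree V) : QueryTree V

/-- The sequence of queries that are made when the precise weights are `w`. -/
def QueryTree.run {V : Type u} (w : V → ℝ) : QueryTree V → List V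
  | .halt => []
  | .query v next => v :: (next (w v)).run w

/-- A deterministic algorithm prescribes an adaptive query strategy for each input. -/
def DetAlg : Type (u + 1) := ∀ (V : Type u) [Fintype V], Input V → QueryTree V

/-- A randomized algorithm is a probability distribution on deterministic algorithms. -/
abbrev RandAlg : Type (u + 1) := PMF DetAlg.{u}

/-- The expected number of queries of a randomized algorithm. -/
def RandAlg.expectedQueries (R : RandAlg.{u}) {V : Type u} [Fintype V] (I : Input V)
    (w : V → ℝ) : ℝ≥0∞ :=
  ∑' a : DetAlg.{u}, R a * (((a V I).run w).length : ℝ≥0∞)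

/-- `R` solves every instance, whatever the outcome of its random choices, and its expected number
of queries is at most `ρ V I w * |OPT|` for every input `I` on a finite vertex set `V` and all
precise weights `w`. -/
def RandAlg.AchievesRatio (R : RandAlg.{u})
    (ρ : ∀ (V : Type u) [Fintype V], Input V → (V → ℝ) → ℝ) : Prop :=
  ∀ (V : Type u) [Fintype V] (I : Input V) (w : V → ℝ), IsRealization I w →
    (∀ a ∈ R.support, Feasible I w ((a V I).run w).toFinset) ∧
    R.expectedQueries I w ≤ ENNReal.ofReal (ρ V I w * (optCard I w : ℝ))

/-! ### Notions used by the algorithm, all for the current instance -/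

/-- `v` is leftmost in `S`: it has minimum lower limit in `S`. -/
def Leftmost {V : Type u} (I : Input V) (K : Known V) (S : Finset V) (v : V) : Prop :=
  v ∈ S ∧ ∀ z ∈ S, lowerLimit I K v ≤ lowerLimit I K z

/-- `v` is known to be mandatory: it is leftmost in a hyperedge that is not yet solved, and its
interval contains the revealed weight or the whole interval of another vertex of that
hyperedge. -/
def KnownMandatory {V : Type u} (I : Input V) (K : Known V) (v : V) : Prop :=
  ∃ S ∈ I.edges, ¬ Solved I K S ∧ Leftmost I K S v ∧ ∃ z ∈ S, z ≠ v ∧ ival I K z ⊆ ival I K v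

/-- `v` belongs to every feasible query set of the current instance if the precise weights
are `w`. -/
def Mandatory {V : Type u} (I : Input V) (K : Known V) (w : V → ℝ) (v : V) : Prop :=
  ∀ Q : Finset V, FeasibleFrom I K w Q → v ∈ Q

/-- `v` is prediction mandatory: it is mandatory if the predicted weights of all vertices that have
not been queried yet are correct. -/
def PredMandatory {V : Type u} (I : Input V) (K : Known V) (v : V) : Prop :=
  Mandatory I K (fun z => (K z).getD (I.pred z)) v

/-- `y` and `z` are two vertices of a not yet solved hyperedge with intersecting intervals, one of
them leftmost. Such pairs are the witness pairs that the algorithm uses. -/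
def WitnessPair {V : Type u} (I : Input V) (K : Known V) (y z : V) : Prop :=
  y ≠ z ∧ ∃ S ∈ I.edges, ¬ Solved I K S ∧ y ∈ S ∧ z ∈ S ∧
    (ival I K y ∩ ival I K z).Nonempty ∧ (Leftmost I K S y ∨ Leftmost I K S z)

/-- The predicted weight of `y` enforces `v`. -/
def Enforces {V : Type u} (I : Input V) (K : Known V) (y v : V) : Prop :=
  y ≠ v ∧ K y = none ∧ K v = none ∧ I.pred y ∈ ival I K v ∧
    ∃ S ∈ I.edges, ¬ Solved I K S ∧ y ∈ S ∧ v ∈ S ∧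
      (Leftmost I K S v ∨ (Leftmost I K S y ∧ Leftmost I K (S.erase y) v))

/-- The vertex cover instance; its edges are the pairs described in `WitnessPair`. -/
def vcGraph {V : Type u} (I : Input V) (K : Known V) : SimpleGraph V where
  Adj y z := WitnessPair I K y z
  symm := ⟨fun _ _ h => by
    obtain ⟨hne, S, hS, hn, hy, hz, hi, hl⟩ := h
    exact ⟨hne.symm, S, hS, hn, hz, hy, by rwa [Set.inter_comm], hl.symm⟩⟩
  loopless := ⟨fun _ h => h.1 rfl⟩

/-- `C` is a minimum vertex cover of `G`. -/
def IsMinVertexCover {V : Type u} (G : SimpleGraph V) (C : Finset V) : Prop :=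
  G.IsVertexCover (C : Set V) ∧ ∀ D : Finset V, G.IsVertexCover (D : Set V) → C.card ≤ D.card

/-! ### The algorithm -/

/-- Control states of the algorithm.
* `exhaust s`: query known mandatory vertices as long as there is one, then go to `s`;
* `collect q`: the while loop that queries up to `g - 2` prediction mandatory vertices, of which
  `q` have been queried in the current iteration of the repeat loop;
* `pairs`: the search for a triple or a pair with an enforced vertex;
* `single v`: query `v`, query known mandatory vertices exhaustively, and go to the test at the
  end of the repeat loop;
* `test`: that test;
* `cover`: compute a minimum vertex cover;
* `sweep C`: query the vertices of `C`, then the known mandatory vertices, and stop;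
* `finish`: stop. -/
inductive Stage (V : Type u) : Type u
  | exhaust (s : Stage V)
  | collect (q : ℕ)
  | pairs
  | single (v : V)
  | test
  | cover
  | sweep (C : Finset V)
  | finish

/-- `Follows I g s K t`: the query strategy `t` carries out the algorithm with the integer parameter
`g` on the input `I`, from the control state `s` and the state of information `K` on, with some
admissible resolution of all choices that the algorithm leaves open. -/
inductive Follows {V : Type u} (I : Input V) (g : ℕ) :
    Stage V → Known V → QueryTree V → Prop
  | exhaust_query {s : Stage V} {K : Known V} (v : V) (next : ℝ → QueryTree V)
      (hv : KnownMandatory I K v)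
      (h : ∀ x ∈ Set.Ioo (I.L v) (I.U v), Follows I g (.exhaust s) (K.update v x) (next x)) :
      Follows I g (.exhaust s) K (.query v next)
  | exhaust_done {s : Stage V} {K : Known V} {t : QueryTree V}
      (hK : ∀ v, ¬ KnownMandatory I K v) (h : Follows I g s K t) :
      Follows I g (.exhaust s) K t
  | collect_query {q : ℕ} {K : Known V} (v : V) (next : ℝ → QueryTree V)
      (hq : q + 2 < g) (hv : PredMandatory I K v)
      (h : ∀ x ∈ Set.Ioo (I.L v) (I.U v),
        Follows I g (.exhaust (.collect (q + 1))) (K.update v x) (next x)) :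
      Follows I g (.collect q) K (.query v next)
  | collect_done {q : ℕ} {K : Known V} {t : QueryTree V}
      (hq : g ≤ q + 2 ∨ ∀ v, ¬ PredMandatory I K v) (h : Follows I g .pairs K t) :
      Follows I g (.collect q) K t
  | pairs_triple {K : Known V} (y v z : V) (next : ℝ → ℝ → QueryTree V)
      (hv : Enforces I K y v) (hz : WitnessPair I K y z) (hvz : v ≠ z)
      (hin : ∀ x ∈ Set.Ioo (I.L y) (I.U y), ∀ x' ∈ Set.Ioo (I.L z) (I.U z), x ∈ ival I K v →
        Follows I g (.single v) ((K.update y x).update z x') (next x x'))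
      (hout : ∀ x ∈ Set.Ioo (I.L y) (I.U y), ∀ x' ∈ Set.Ioo (I.L z) (I.U z), x ∉ ival I K v →
        Follows I g (.exhaust .test) ((K.update y x).update z x') (next x x')) :
      Follows I g .pairs K (.query y fun x => .query z fun x' => next x x')
  | pairs_pair {K : Known V} {t : QueryTree V} (y v : V)
      (hno : ∀ y v z, Enforces I K y v → WitnessPair I K y z → v = z)
      (hv : Enforces I K y v) (h : Follows I g (.single v) K t) :
      Follows I g .pairs K t
  | pairs_none {K : Known V} {t : QueryTree V}
      (hno : ∀ y v, ¬ Enforces I K y v) (h : Follows I g (.exhaust .test) K t) :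
      Follows I g .pairs K t
  | single_query {K : Known V} (v : V) (next : ℝ → QueryTree V)
      (h : ∀ x ∈ Set.Ioo (I.L v) (I.U v),
        Follows I g (.exhaust .test) (K.update v x) (next x)) :
      Follows I g (.single v) K (.query v next)
  | test_repeat {K : Known V} {t : QueryTree V} (v : V) (hv : PredMandatory I K v)
      (h : Follows I g (.collect 0) K t) :
      Follows I g .test K t
  | test_exit {K : Known V} {t : QueryTree V} (hK : ∀ v, ¬ PredMandatory I K v)
      (h : Follows I g .cover K t) :
      Follows I g .test K t
  | cover {K : Known V} {t : QueryTree V} (C : Finset V) (hC : IsMinVertexCover (vcGraph I K) C)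
      (h : Follows I g (.sweep C) K t) :
      Follows I g .cover K t
  | sweep_query {C : Finset V} {K : Known V} (v : V) (next : ℝ → QueryTree V) (hv : v ∈ C)
      (h : ∀ x ∈ Set.Ioo (I.L v) (I.U v),
        Follows I g (.sweep (C.erase v)) (K.update v x) (next x)) :
      Follows I g (.sweep C) K (.query v next)
  | sweep_done {K : Known V} {t : QueryTree V} (h : Follows I g (.exhaust .finish) K t) :
      Follows I g (.sweep ∅) K t
  | finish {K : Known V} : Follows I g .finish K .halt

/-- `A` is an implementation of the algorithm with the integer parameter `g`. -/
def Implements (g : ℕ) (A : DetAlg.{u}) : Prop :=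
  ∀ (V : Type u) [Fintype V] (I : Input V),
    Follows I g (.exhaust (.collect 0)) (Known.initial V) (A V I)

/-- A biased coin that shows `true` with probability the fractional part of `γ`. -/
def fractCoin (γ : ℝ) : PMF Bool :=
  PMF.ofFintype (fun b => ENNReal.ofReal (if b then Int.fract γ else 1 - Int.fract γ)) (by
    have h0 := Int.fract_nonneg γ
    have h1 := (Int.fract_lt_one γ).le
    simp only [Fintype.sum_bool, if_true, Bool.false_eq_true, if_false]
    rw [← ENNReal.ofReal_add h0 (by linarith)]
    simp)

/-- The randomized algorithm that runs `A ⌈γ⌉` with probability the fractional part of `γ` and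
`A ⌊γ⌋` with the remaining probability. -/
def roundRandomly (A : ℕ → DetAlg.{u}) (γ : ℝ) : RandAlg.{u} :=
  (fractCoin γ).map fun b => A (if b then ⌈γ⌉₊ else ⌊γ⌋₊)

end HypOrient

end

/-!
Fix `g ≥ 2`, and let `o` be the optimum and `k` the hop distance of the current instance, the latter
counting only pairs of unqueried vertices. From each state on, at most `g * o` queries are made,
and at most `(1 + 1 / g) * (o + k)`.

An unqueried vertex is mandatory iff some hyperedge `S` contains it such that the minimum weight of
the other vertices of `S` lies in its interval. Hence a prediction mandatory vertex `v` that turns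
out not to be mandatory is paid for by a hop of some other weight relative to `v`, so every query of
a prediction mandatory vertex lowers `o + k`. The remaining queries of an iteration of the repeat
loop are charged as follows. If `y` enforces `v` and `{y, z}` is a witness pair with `z ≠ v`, then
every feasible set contains `y` or `z`; if the weight of `y` lies in the interval of `v`, then `v`
is mandatory as well, and otherwise `y` hops relative to `v`. If `v` is the only witness of `y`,
then after the query of `v` either a known mandatory vertex appears, or `y` need not be queried any
more. So an iteration makes at most one query more than it lowers `o + k`, which is made up for
by the `g - 2` preceding queries of prediction mandatory vertices and the two queries that are paid.

Without prediction mandatory vertices every mandatory vertex has a hop of its own, which makes the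
vertex cover phase cost at most `min (2 * o) (o + k)`. Finally, `g` has mean `γ` under the random
rounding of `γ`, and the excess of the mean of `1 / g` over `1 / γ` is `f (1 - f) / (n (n + 1) γ)`
with `n = ⌊γ⌋` and `f = γ - n`, which is at most `1 / 48`.
-/

noncomputable section

namespace HypOrient

open scoped Classical

variable {V : Type u} {I : Input V} {K K' : Known V} {w : V → ℝ} {S P Q : Finset V}
  {a m v y z : V} {x : ℝ}

/-! ### States of information -/

/-- The upper limit of the current uncertainty interval of `v`. -/
def upperLimit (I : Input V) (K : Known V) (v : V) : ℝ := (K v).getD (I.U v)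

/-- The known weights, completed by the predictions. `PredMandatory I K` is `Mandatory I K` for
these weights. -/
def guess (I : Input V) (K : Known V) : V → ℝ := fun z => (K z).getD (I.pred z)

/-- The recorded answers lie in the uncertainty intervals, so that some admissible weights produce
them. -/
def Consistent (I : Input V) (K : Known V) : Prop :=
  ∀ z x, K z = some x → x ∈ Set.Ioo (I.L z) (I.U z)

/-- The precise weights `w` are admissible and produce the answers recorded in `K`. -/
structure Compatible (I : Input V) (K : Known V) (w : V → ℝ) : Prop where
  realization : IsRealization I w
  eq_of_known : ∀ z x, K z = some x → w z = x

lemma ival_of_eq_none (h : K v = none) : ival I K v = Set.Ioo (I.L v) (I.U v) := by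
  simp [ival, h]

lemma ival_of_eq_some (h : K v = some x) : ival I K v = {x} := by simp [ival, h]

lemma lowerLimit_of_eq_none (h : K v = none) : lowerLimit I K v = I.L v := by
  simp [lowerLimit, h]

lemma lowerLimit_of_eq_some (h : K v = some x) : lowerLimit I K v = x := by
  simp [lowerLimit, h]

lemma upperLimit_of_eq_none (h : K v = none) : upperLimit I K v = I.U v := by
  simp [upperLimit, h]

lemma upperLimit_of_eq_some (h : K v = some x) : upperLimit I K v = x := by
  simp [upperLimit, h]

lemma lowerLimit_le_of_mem_ival (h : x ∈ ival I K v) : lowerLimit I K v ≤ x := by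
  rcases hv : K v with _ | b
  · rw [ival_of_eq_none hv] at h
    exact (lowerLimit_of_eq_none hv).trans_le h.1.le
  · rw [ival_of_eq_some hv] at h
    exact (lowerLimit_of_eq_some hv).trans_le (Set.mem_singleton_iff.1 h).ge

lemma le_upperLimit_of_mem_ival (h : x ∈ ival I K v) : x ≤ upperLimit I K v := by
  rcases hv : K v with _ | b
  · rw [ival_of_eq_none hv] at h
    exact h.2.le.trans_eq (upperLimit_of_eq_none hv).symm
  · rw [ival_of_eq_some hv] at h
    exact (Set.mem_singleton_iff.1 h).le.trans_eq (upperLimit_of_eq_some hv).symm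

lemma guess_mem_ival (I : Input V) (K : Known V) (v : V) : guess I K v ∈ ival I K v := by
  rcases hv : K v with _ | b
  · simpa [ival_of_eq_none hv, guess, hv] using I.pred_mem v
  · simp [ival_of_eq_some hv, guess, hv]

lemma guess_of_eq_none (h : K v = none) : guess I K v = I.pred v := by simp [guess, h]

lemma consistent_initial (I : Input V) : Consistent I (Known.initial V) :=
  fun _ _ h => (Option.some_ne_none _ h.symm).elim

lemma Consistent.update (h : Consistent I K) (hx : x ∈ Set.Ioo (I.L v) (I.U v)) :
    Consistent I (K.update v x) := by
  intro z b hb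
  rcases eq_or_ne z v with rfl | hz
  · simp only [Known.update, if_true, Option.some.injEq] at hb
    exact hb ▸ hx
  · exact h z b (by simpa [Known.update, hz] using hb)

lemma Consistent.compatible_guess (h : Consistent I K) : Compatible I K (guess I K) where
  realization z := by
    rcases hz : K z with _ | b
    · simpa [guess, hz] using I.pred_mem z
    · simpa [guess, hz] using h z b hz
  eq_of_known z b hz := by simp [guess, hz]

lemma IsRealization.compatible_initial (h : IsRealization I w) :
    Compatible I (Known.initial V) w :=
  ⟨h, fun _ _ h => (Option.some_ne_none _ h.symm).elim⟩

namespace Compatible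

lemma consistent (h : Compatible I K w) : Consistent I K :=
  fun z x hz => h.eq_of_known z x hz ▸ h.realization z

lemma eq_some (h : Compatible I K w) (hv : K v ≠ none) : K v = some (w v) := by
  obtain ⟨b, hb⟩ := Option.ne_none_iff_exists'.1 hv
  rw [hb, h.eq_of_known v b hb]

lemma mem_ival (h : Compatible I K w) (v : V) : w v ∈ ival I K v := by
  by_cases hv : K v = none
  · exact (ival_of_eq_none hv).symm ▸ h.realization v
  · simp [ival_of_eq_some (h.eq_some hv)]

end Compatible

/-! ### Revealing weights -/

lemma reveal_of_mem (h : z ∈ Q) : K.reveal w Q z = some (w z) := by simp [Known.reveal, h]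

lemma reveal_of_notMem (h : z ∉ Q) : K.reveal w Q z = K z := by simp [Known.reveal, h]

lemma reveal_eq_none_iff : K.reveal w Q z = none ↔ z ∉ Q ∧ K z = none := by
  by_cases hz : z ∈ Q <;> simp [Known.reveal, hz]

lemma reveal_empty (K : Known V) (w : V → ℝ) : K.reveal w ∅ = K := by
  funext z
  simp [Known.reveal]

lemma reveal_reveal (K : Known V) (w : V → ℝ) (P Q : Finset V) :
    (K.reveal w P).reveal w Q = K.reveal w (P ∪ Q) := by
  funext z
  by_cases hP : z ∈ P <;> by_cases hQ : z ∈ Q <;> simp [Known.reveal, hP, hQ]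

lemma update_eq_reveal (K : Known V) (w : V → ℝ) (v : V) :
    K.update v (w v) = K.reveal w {v} := by
  funext z
  rcases eq_or_ne z v with rfl | hz
  · simp [Known.reveal, Known.update]
  · simp [Known.reveal, Known.update, hz]

lemma reveal_update (K : Known V) (w : V → ℝ) (v : V) (Q : Finset V) :
    (K.update v (w v)).reveal w Q = K.reveal w (insert v Q) := by
  rw [update_eq_reveal, reveal_reveal, Finset.singleton_union]

lemma update_update_eq_reveal (K : Known V) (w : V → ℝ) (y z : V) :
    (K.update y (w y)).update z (w z) = K.reveal w {y, z} := by
  rw [update_eq_reveal _ w z, reveal_update]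

namespace Compatible

lemma reveal (h : Compatible I K w) (Q : Finset V) : Compatible I (K.reveal w Q) w where
  realization := h.realization
  eq_of_known z x hz := by
    by_cases hQ : z ∈ Q
    · exact Option.some.inj ((reveal_of_mem hQ).symm.trans hz)
    · exact h.eq_of_known z x ((reveal_of_notMem hQ).symm.trans hz)

lemma update (h : Compatible I K w) (v : V) : Compatible I (K.update v (w v)) w :=
  update_eq_reveal K w v ▸ h.reveal {v}

lemma ival_reveal_subset (h : Compatible I K w) (Q : Finset V) (z : V) :
    ival I (K.reveal w Q) z ⊆ ival I K z := by
  by_cases hz : z ∈ Q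
  · rw [ival_of_eq_some (reveal_of_mem hz), Set.singleton_subset_iff]
    exact h.mem_ival z
  · simp [ival, reveal_of_notMem hz]

lemma reveal_erase (h : Compatible I K w) (hv : K v ≠ none) (Q : Finset V) :
    K.reveal w (Q.erase v) = K.reveal w Q := by
  funext z
  rcases eq_or_ne z v with rfl | hz
  · simp [Known.reveal, h.eq_some hv]
  · simp [Known.reveal, hz]

end Compatible

/-! ### Solved hyperedges -/

lemma exists_lt_of_lowerLimit_lt_upperLimit (h : lowerLimit I K z < upperLimit I K v) :
    ∃ b ∈ ival I K z, ∃ c ∈ ival I K v, b < c := by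
  obtain ⟨b, hb, hbv⟩ : ∃ b ∈ ival I K z, b < upperLimit I K v := by
    rcases hz : K z with _ | b
    · rw [lowerLimit_of_eq_none hz] at h
      obtain ⟨b, hLb, hb⟩ := exists_between (lt_min (I.L_lt_U z) h)
      rw [lt_min_iff] at hb
      exact ⟨b, by simpa [ival_of_eq_none hz] using ⟨hLb, hb.1⟩, hb.2⟩
    · exact ⟨b, by simp [ival_of_eq_some hz], by rwa [lowerLimit_of_eq_some hz] at h⟩
  refine ⟨b, hb, ?_⟩
  rcases hv : K v with _ | c
  · rw [upperLimit_of_eq_none hv] at hbv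
    obtain ⟨c, hc, hcU⟩ := exists_between (max_lt (I.L_lt_U v) hbv)
    rw [max_lt_iff] at hc
    exact ⟨c, by simpa [ival_of_eq_none hv] using ⟨hc.1, hcU⟩, hc.2⟩
  · exact ⟨c, by simp [ival_of_eq_some hv], by rwa [upperLimit_of_eq_some hv] at hbv⟩

lemma solved_iff : Solved I K S ↔
    ∃ v ∈ S, ∀ z ∈ S, z ≠ v → upperLimit I K v ≤ lowerLimit I K z := by
  constructor
  · rintro ⟨v, hv, h⟩
    refine ⟨v, hv, fun z hz hzv => ?_⟩
    by_contra! hlt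
    obtain ⟨b, hb, c, hc, hbc⟩ := exists_lt_of_lowerLimit_lt_upperLimit hlt
    let w' := Function.update (Function.update (guess I K) z b) v c
    have hw' : ∀ t, w' t ∈ ival I K t := fun t => by
      rcases eq_or_ne t v with rfl | htv
      · simpa [w'] using hc
      · rcases eq_or_ne t z with rfl | htz
        · simpa [w', htv] using hb
        · simpa [w', htv, htz] using guess_mem_ival I K t
    exact hbc.not_ge (by simpa [w', hzv] using h w' hw' z hz)
  · rintro ⟨v, hv, h⟩
    refine ⟨v, hv, fun w' hw' z hz => ?_⟩
    rcases eq_or_ne z v with rfl | hzv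
    · exact le_rfl
    · exact (le_upperLimit_of_mem_ival (hw' v)).trans
        ((h z hz hzv).trans (lowerLimit_le_of_mem_ival (hw' z)))

lemma Solved.reveal (hS : Solved I K S) (h : Compatible I K w) (Q : Finset V) :
    Solved I (K.reveal w Q) S := by
  obtain ⟨v, hv, hmin⟩ := hS
  exact ⟨v, hv, fun w' hw' => hmin w' fun z => h.ival_reveal_subset Q z (hw' z)⟩

lemma Solved.congr (hS : Solved I K S) (h : ∀ z ∈ S, K z = K' z) : Solved I K' S := by
  rw [solved_iff] at hS ⊢
  obtain ⟨v, hv, hmin⟩ := hS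
  exact ⟨v, hv, fun z hz hzv => by
    simpa [upperLimit, lowerLimit, h z hz, h v hv] using hmin z hz hzv⟩

lemma solved_reveal_of_subset (hS : S.Nonempty) (h : S ⊆ Q) : Solved I (K.reveal w Q) S := by
  obtain ⟨v, hv, hmin⟩ := S.exists_min_image w hS
  refine solved_iff.2 ⟨v, hv, fun z hz _ => ?_⟩
  rw [upperLimit_of_eq_some (reveal_of_mem (h hv)), lowerLimit_of_eq_some (reveal_of_mem (h hz))]
  exact hmin z hz

lemma exists_leftmost (I : Input V) (K : Known V) (hS : S.Nonempty) : ∃ v, Leftmost I K S v :=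
  S.exists_min_image (lowerLimit I K) hS

lemma Leftmost.eq_none (h : Leftmost I K S v) (hS : ¬ Solved I K S) : K v = none := by
  by_contra hv
  obtain ⟨b, hb⟩ := Option.ne_none_iff_exists'.1 hv
  refine hS (solved_iff.2 ⟨v, h.1, fun z hz _ => ?_⟩)
  rw [upperLimit_of_eq_some hb, ← lowerLimit_of_eq_some (I := I) hb]
  exact h.2 z hz

lemma Leftmost.lt_of_mem_ival (h : Leftmost I K S v) (hS : ¬ Solved I K S) (hy : y ∈ S)
    (hx : x ∈ ival I K y) : I.L v < x := by
  have hle := h.2 y hy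
  rw [lowerLimit_of_eq_none (h.eq_none hS)] at hle
  rcases hKy : K y with _ | b
  · rw [lowerLimit_of_eq_none hKy] at hle
    rw [ival_of_eq_none hKy] at hx
    exact hle.trans_lt hx.1
  · rw [ival_of_eq_some hKy, Set.mem_singleton_iff] at hx
    subst hx
    rw [lowerLimit_of_eq_some hKy] at hle
    refine hle.lt_of_ne fun heq => ?_
    have hyl : Leftmost I K S y := ⟨hy, fun z hz => by
      have := h.2 z hz
      rwa [lowerLimit_of_eq_none (h.eq_none hS), heq, ← lowerLimit_of_eq_some (I := I) hKy]
        at this⟩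
    simp [hyl.eq_none hS] at hKy

lemma KnownMandatory.eq_none (h : KnownMandatory I K v) : K v = none := by
  obtain ⟨S, -, hn, hl, -⟩ := h
  exact hl.eq_none hn

/-! ### Feasible query sets and mandatory vertices -/

lemma exists_feasibleFrom (I : Input V) (K : Known V) (w : V → ℝ) :
    ∃ Q, FeasibleFrom I K w Q :=
  ⟨I.edges.biUnion id, fun S hS => solved_reveal_of_subset (I.edges_nonempty S hS)
    (Finset.subset_biUnion_of_mem id hS)⟩

lemma feasibleFrom_reveal_iff :
    FeasibleFrom I (K.reveal w P) w Q ↔ FeasibleFrom I K w (P ∪ Q) := by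
  simp only [FeasibleFrom, reveal_reveal]

lemma FeasibleFrom.mono (hP : FeasibleFrom I K w P) (h : Compatible I K w) (hPQ : P ⊆ Q) :
    FeasibleFrom I K w Q := by
  intro S hS
  have := (hP S hS).reveal (h.reveal P) Q
  rwa [reveal_reveal, Finset.union_eq_right.2 hPQ] at this

lemma FeasibleFrom.sdiff (hQ : FeasibleFrom I K w Q) (h : Compatible I K w) (P : Finset V) :
    FeasibleFrom I (K.reveal w P) w (Q \ P) := by
  rw [feasibleFrom_reveal_iff, Finset.union_sdiff_self_eq_union]
  exact hQ.mono h Finset.subset_union_right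

lemma FeasibleFrom.erase_of_known (hQ : FeasibleFrom I K w Q) (h : Compatible I K w)
    (hv : K v ≠ none) : FeasibleFrom I K w (Q.erase v) := fun S hS => by
  rw [h.reveal_erase hv]
  exact hQ S hS

/-- The minimum weight of the vertices of `S` other than `m` lies in the initial interval of `m`,
so that `S` cannot be solved without a query of `m`. -/
def ForcesQuery (I : Input V) (w : V → ℝ) (S : Finset V) (m : V) : Prop :=
  m ∈ S ∧ (∀ z ∈ S, z ≠ m → I.L m < w z) ∧ ∃ z ∈ S, z ≠ m ∧ w z < I.U m

/-- Some hyperedge forces a query of `m`. For unqueried vertices this characterizes mandatory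
vertices, in a form that does not depend on the state of information. -/
def MustQuery (I : Input V) (w : V → ℝ) (m : V) : Prop :=
  ∃ S ∈ I.edges, ForcesQuery I w S m

lemma ForcesQuery.not_solved (hS : ForcesQuery I w S m) (h : Compatible I K w)
    (hm : K m = none) : ¬ Solved I K S := by
  obtain ⟨hmS, hL, y, hy, hym, hU⟩ := hS
  rw [solved_iff]
  rintro ⟨v, hv, hmin⟩
  rcases eq_or_ne v m with rfl | hvm
  · have := hmin y hy hym
    rw [upperLimit_of_eq_none hm] at this
    exact hU.not_ge (this.trans (lowerLimit_le_of_mem_ival (h.mem_ival y)))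
  · have := hmin m hmS hvm.symm
    rw [lowerLimit_of_eq_none hm] at this
    exact (hL v hv hvm).not_ge ((le_upperLimit_of_mem_ival (h.mem_ival v)).trans this)

lemma solved_of_not_forcesQuery (hne : S.Nonempty) (hm : K m = none)
    (hz : ∀ z ∈ S, z ≠ m → K z = some (w z)) (hF : ¬ ForcesQuery I w S m) : Solved I K S := by
  rw [solved_iff]
  by_cases hmin : m ∈ S ∧ ∀ z ∈ S, z ≠ m → I.U m ≤ w z
  · refine ⟨m, hmin.1, fun z hzS hzm => ?_⟩
    rw [upperLimit_of_eq_none hm, lowerLimit_of_eq_some (hz z hzS hzm)]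
    exact hmin.2 z hzS hzm
  have hothers : (S.erase m).Nonempty := by
    rw [Finset.nonempty_iff_ne_empty, Ne, Finset.erase_eq_empty_iff]
    rintro (rfl | rfl)
    · exact Finset.not_nonempty_empty hne
    · exact hmin ⟨by simp, by simp⟩
  obtain ⟨v, hv, hvmin⟩ := (S.erase m).exists_min_image w hothers
  rw [Finset.mem_erase] at hv
  refine ⟨v, hv.2, fun z hzS _ => ?_⟩
  rw [upperLimit_of_eq_some (hz v hv.2 hv.1)]
  rcases eq_or_ne z m with rfl | hzm
  · rw [lowerLimit_of_eq_none hm]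
    by_contra! hlt
    refine hF ⟨hzS, fun t ht htz => hlt.trans_le (hvmin t (Finset.mem_erase.2 ⟨htz, ht⟩)), ?_⟩
    by_contra! hU
    exact hmin ⟨hzS, hU⟩
  · rw [lowerLimit_of_eq_some (hz z hzS hzm)]
    exact hvmin z (Finset.mem_erase.2 ⟨hzm, hzS⟩)

lemma mandatory_iff (h : Compatible I K w) :
    Mandatory I K w m ↔ K m = none ∧ MustQuery I w m := by
  constructor
  · intro hm
    obtain ⟨Q, hQ⟩ := exists_feasibleFrom I K w
    have hnone : K m = none := by
      by_contra hne
      exact Finset.notMem_erase m Q (hm _ (hQ.erase_of_known h hne))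
    refine ⟨hnone, ?_⟩
    by_contra hnot
    refine Finset.notMem_erase m (I.edges.biUnion id) (hm _ fun S hS => ?_)
    refine solved_of_not_forcesQuery (w := w) (I.edges_nonempty S hS)
      (reveal_eq_none_iff.2 ⟨Finset.notMem_erase m _, hnone⟩)
      (fun z hz hzm => reveal_of_mem (Finset.mem_erase.2 ⟨hzm, ?_⟩)) fun hF => hnot ⟨S, hS, hF⟩
    exact Finset.mem_biUnion.2 ⟨S, hS, hz⟩
  · rintro ⟨hnone, S, hS, hF⟩ Q hQ
    by_contra hmQ
    exact hF.not_solved (h.reveal Q) (reveal_eq_none_iff.2 ⟨hmQ, hnone⟩) (hQ S hS)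

lemma predMandatory_iff (h : Consistent I K) :
    PredMandatory I K m ↔ K m = none ∧ MustQuery I (guess I K) m :=
  mandatory_iff h.compatible_guess

lemma Mandatory.reveal (hm : Mandatory I K w m) (hP : m ∉ P) :
    Mandatory I (K.reveal w P) w m := fun _ hQ =>
  (Finset.mem_union.1 (hm _ (feasibleFrom_reveal_iff.1 hQ))).resolve_left hP

lemma KnownMandatory.mandatory (hv : KnownMandatory I K v) (h : Compatible I K w) :
    Mandatory I K w v := by
  refine (mandatory_iff h).2 ⟨hv.eq_none, ?_⟩
  have hnone := hv.eq_none
  obtain ⟨S, hS, hn, hl, z, hz, hzv, hsub⟩ := hv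
  refine ⟨S, hS, hl.1, fun y hy _ => hl.lt_of_mem_ival hn hy (h.mem_ival y), z, hz, hzv, ?_⟩
  have := hsub (h.mem_ival z)
  rw [ival_of_eq_none hnone] at this
  exact this.2

/-! ### States without known mandatory vertices -/

/-- There is no known mandatory vertex. -/
def Exhausted (I : Input V) (K : Known V) : Prop := ∀ v, ¬ KnownMandatory I K v

namespace Exhausted

lemma U_le_of_known (hE : Exhausted I K) (hS : S ∈ I.edges) (hn : ¬ Solved I K S)
    (ha : Leftmost I K S a) (hz : z ∈ S) (hx : K z = some x) : I.U a ≤ x := by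
  by_contra! hlt
  refine hE a ⟨S, hS, hn, ha, z, hz, ?_, ?_⟩
  · rintro rfl
    simp [ha.eq_none hn] at hx
  · rw [ival_of_eq_some hx, ival_of_eq_none (ha.eq_none hn), Set.singleton_subset_iff]
    exact ⟨ha.lt_of_mem_ival hn hz (by simp [ival_of_eq_some hx]), hlt⟩

lemma U_lt_U (hE : Exhausted I K) (hS : S ∈ I.edges) (hn : ¬ Solved I K S)
    (ha : Leftmost I K S a) (hz : z ∈ S) (hza : z ≠ a) (hzn : K z = none) : I.U a < I.U z := by
  by_contra! hle
  refine hE a ⟨S, hS, hn, ha, z, hz, hza, ?_⟩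
  rw [ival_of_eq_none hzn, ival_of_eq_none (ha.eq_none hn)]
  have := ha.2 z hz
  rw [lowerLimit_of_eq_none (ha.eq_none hn), lowerLimit_of_eq_none hzn] at this
  exact Set.Ioo_subset_Ioo this hle

lemma exists_inter (hE : Exhausted I K) (hS : S ∈ I.edges) (hn : ¬ Solved I K S)
    (ha : Leftmost I K S a) :
    ∃ z ∈ S, z ≠ a ∧ K z = none ∧ (ival I K a ∩ ival I K z).Nonempty := by
  have han := ha.eq_none hn
  obtain ⟨z, hz, hza, hlt⟩ : ∃ z ∈ S, z ≠ a ∧ lowerLimit I K z < I.U a := by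
    by_contra! hc
    exact hn (solved_iff.2 ⟨a, ha.1, fun z hz hza =>
      (upperLimit_of_eq_none han).trans_le (hc z hz hza)⟩)
  have hzn : K z = none := by
    by_contra hc
    obtain ⟨x, hx⟩ := Option.ne_none_iff_exists'.1 hc
    rw [lowerLimit_of_eq_some hx] at hlt
    exact hlt.not_ge (hE.U_le_of_known hS hn ha hz hx)
  refine ⟨z, hz, hza, hzn, ?_⟩
  have hle := ha.2 z hz
  rw [lowerLimit_of_eq_none hzn] at hlt hle
  rw [lowerLimit_of_eq_none han] at hle
  rw [ival_of_eq_none han, ival_of_eq_none hzn, Set.Ioo_inter_Ioo, sup_eq_right.2 hle]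
  exact Set.nonempty_Ioo.2 (lt_min hlt (I.L_lt_U z))

end Exhausted

lemma WitnessPair.eq_none (h : WitnessPair I K y z) (hE : Exhausted I K) :
    K y = none ∧ K z = none := by
  obtain ⟨hne, S, hS, hn, hy, hz, hi, hl⟩ := h
  wlog hly : Leftmost I K S y generalizing y z
  · exact (this hne.symm hz hy (Set.inter_comm _ _ ▸ hi) hl.symm (hl.resolve_left hly)).symm
  refine ⟨hly.eq_none hn, ?_⟩
  by_contra hc
  obtain ⟨x, hx⟩ := Option.ne_none_iff_exists'.1 hc
  obtain ⟨b, hby, hbz⟩ := hi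
  rw [ival_of_eq_some hx, Set.mem_singleton_iff] at hbz
  rw [ival_of_eq_none (hly.eq_none hn)] at hby
  exact (hbz ▸ hby.2).not_ge (hE.U_le_of_known hS hn hly hz hx)

lemma WitnessPair.mem_or_mem (hyz : WitnessPair I K y z) (hE : Exhausted I K)
    (h : Compatible I K w) (hQ : FeasibleFrom I K w Q) : y ∈ Q ∨ z ∈ Q := by
  obtain ⟨hyn, hzn⟩ := hyz.eq_none hE
  obtain ⟨hne, S, hS, hn, hy, hz, hi, hl⟩ := hyz
  wlog hly : Leftmost I K S y generalizing y z
  · exact (this hzn hyn hne.symm hz hy (Set.inter_comm _ _ ▸ hi) hl.symm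
      (hl.resolve_left hly)).symm
  by_contra! hc
  have hy' := reveal_eq_none_iff (w := w).2 ⟨hc.1, hyn⟩
  have hz' := reveal_eq_none_iff (w := w).2 ⟨hc.2, hzn⟩
  obtain ⟨v, hv, hmin⟩ := solved_iff.1 (hQ S hS)
  rcases eq_or_ne v y with rfl | hvy
  · obtain ⟨b, hby, hbz⟩ := hi
    rw [ival_of_eq_none hyn] at hby
    rw [ival_of_eq_none hzn] at hbz
    have := hmin z hz hne.symm
    rw [upperLimit_of_eq_none hy', lowerLimit_of_eq_none hz'] at this
    exact (hbz.1.trans hby.2).not_ge this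
  · have := hmin y hy hvy.symm
    rw [lowerLimit_of_eq_none hy'] at this
    exact (hly.lt_of_mem_ival hn hv (h.mem_ival v)).not_ge
      ((le_upperLimit_of_mem_ival ((h.reveal Q).mem_ival v)).trans this)

lemma Enforces.witnessPair (h : Enforces I K y v) : WitnessPair I K y v := by
  obtain ⟨hne, hy, -, hp, S, hS, hn, hyS, hvS, hl⟩ := h
  exact ⟨hne, S, hS, hn, hyS, hvS, ⟨I.pred y, (ival_of_eq_none hy).symm ▸ I.pred_mem y, hp⟩,
    hl.symm.imp_left And.left⟩

lemma Enforces.mandatory (hyv : Enforces I K y v) (hE : Exhausted I K) (h : Compatible I K w)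
    (hy : w y ∈ ival I K v) : Mandatory I K w v := by
  obtain ⟨hne, hyn, hvn, -, S, hS, hn, hyS, hvS, hl⟩ := hyv
  rw [ival_of_eq_none hvn] at hy
  refine (mandatory_iff h).2 ⟨hvn, S, hS, hvS, fun z hz _ => ?_, y, hyS, hne, hy.2⟩
  rcases hl with hl | ⟨hly, hlv⟩
  · exact hl.lt_of_mem_ival hn hz (h.mem_ival z)
  rcases eq_or_ne z y with rfl | hzy
  · exact hy.1
  have hle := hlv.2 z (Finset.mem_erase.2 ⟨hzy, hz⟩)
  rw [lowerLimit_of_eq_none hvn] at hle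
  by_cases hzn : K z = none
  · rw [lowerLimit_of_eq_none hzn] at hle
    exact hle.trans_lt (h.realization z).1
  · exact (hy.1.trans (h.realization y).2).trans_le
      (hE.U_le_of_known hS hn hly hz (h.eq_some hzn))

lemma Enforces.predMandatory (hyv : Enforces I K y v) (hE : Exhausted I K)
    (h : Consistent I K) : PredMandatory I K v := by
  have hmem : guess I K y ∈ ival I K v := by
    rw [guess_of_eq_none hyv.2.1]
    exact hyv.2.2.2.1
  exact hyv.mandatory hE h.compatible_guess hmem

lemma Exhausted.enforces_of_leftmost_erase {b : V} (hE : Exhausted I K) (hS : S ∈ I.edges)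
    (hn : ¬ Solved I K S) (hy : Leftmost I K S y) (hb : Leftmost I K (S.erase y) b)
    (hlt : lowerLimit I K b < I.pred y) : Enforces I K y b := by
  obtain ⟨hby, hbS⟩ := Finset.mem_erase.1 hb.1
  have hbn : K b = none := by
    by_contra hc
    obtain ⟨x, hx⟩ := Option.ne_none_iff_exists'.1 hc
    rw [lowerLimit_of_eq_some hx] at hlt
    exact (hlt.trans (I.pred_mem y).2).not_ge (hE.U_le_of_known hS hn hy hbS hx)
  refine ⟨hby.symm, hy.eq_none hn, hbn, ?_, S, hS, hn, hy.1, hbS, Or.inr ⟨hy, hb⟩⟩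
  rw [ival_of_eq_none hbn]
  exact ⟨lowerLimit_of_eq_none hbn ▸ hlt,
    (I.pred_mem y).2.trans (hE.U_lt_U hS hn hy hbS hby hbn)⟩

lemma PredMandatory.exists_enforces (hv : PredMandatory I K v) (hE : Exhausted I K)
    (h : Consistent I K) : ∃ y v', Enforces I K y v' := by
  obtain ⟨hvn, S, hS, hF⟩ := (predMandatory_iff h).1 hv
  have hn := hF.not_solved h.compatible_guess hvn
  obtain ⟨hvS, hL, z, hz, hzv, hU⟩ := hF
  obtain ⟨y, hy⟩ := exists_leftmost I K ⟨v, hvS⟩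
  have hyn := hy.eq_none hn
  rcases eq_or_ne v y with rfl | hvy
  · have hzn : K z = none := by
      by_contra hc
      exact hU.not_ge (hE.U_le_of_known hS hn hy hz (h.compatible_guess.eq_some hc))
    refine ⟨z, v, hzv, hzn, hvn, ?_, S, hS, hn, hz, hvS, Or.inl hy⟩
    rw [ival_of_eq_none hvn, ← guess_of_eq_none hzn]
    exact ⟨hL z hz hzv, hU⟩
  · have hvy' : v ∈ S.erase y := Finset.mem_erase.2 ⟨hvy, hvS⟩
    obtain ⟨b, hb⟩ := exists_leftmost I K ⟨v, hvy'⟩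
    refine ⟨y, b, hE.enforces_of_leftmost_erase hS hn hy hb ((hb.2 v hvy').trans_lt ?_)⟩
    rw [lowerLimit_of_eq_none hvn, ← guess_of_eq_none hyn]
    exact hL y hy.1 hvy.symm

lemma Leftmost.of_reveal (ha : Leftmost I (K.reveal w Q) S a) (hE : Exhausted I K)
    (hE' : Exhausted I (K.reveal w Q)) (h : Compatible I K w) (hS : S ∈ I.edges)
    (hn : ¬ Solved I (K.reveal w Q) S) : Leftmost I K S a := by
  have hnK : ¬ Solved I K S := fun hs => hn (hs.reveal h Q)
  have haQ := ha.eq_none hn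
  have haK := (reveal_eq_none_iff.1 haQ).2
  obtain ⟨b, hb⟩ := exists_leftmost I K ⟨a, ha.1⟩
  have hbK := hb.eq_none hnK
  suffices hle : I.L a ≤ I.L b from ⟨ha.1, fun z hz =>
    (lowerLimit_of_eq_none haK).trans_le
      (hle.trans ((lowerLimit_of_eq_none hbK).symm.trans_le (hb.2 z hz)))⟩
  by_cases hbQ : K.reveal w Q b = none
  · simpa only [lowerLimit_of_eq_none haQ, lowerLimit_of_eq_none hbQ] using ha.2 b hb.1
  · rcases eq_or_ne a b with rfl | hab
    · exact le_rfl
    have hUw : I.U a ≤ w b := hE'.U_le_of_known hS hn ha hb.1 ((h.reveal Q).eq_some hbQ)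
    exact absurd (hE.U_lt_U hS hnK hb ha.1 hab haK)
      (hUw.trans (h.realization b).2.le).not_gt

lemma solved_reveal_of_isVertexCover (hE : Exhausted I K) (hE' : Exhausted I (K.reveal w Q))
    (h : Compatible I K w) (hC : (vcGraph I K).IsVertexCover (Q : Set V)) (hS : S ∈ I.edges) :
    Solved I (K.reveal w Q) S := by
  by_contra hn
  obtain ⟨a, ha⟩ := exists_leftmost I (K.reveal w Q) (I.edges_nonempty S hS)
  obtain ⟨z, hz, hza, hzn, b, hba, hbz⟩ := hE'.exists_inter hS hn ha
  have hadj : (vcGraph I K).Adj a z :=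
    ⟨hza.symm, S, hS, fun hs => hn (hs.reveal h Q), ha.1, hz,
      ⟨b, h.ival_reveal_subset Q a hba, h.ival_reveal_subset Q z hbz⟩,
      Or.inl (ha.of_reveal hE hE' h hS hn)⟩
  rcases hC hadj with hQ | hQ
  · exact (reveal_eq_none_iff.1 (ha.eq_none hn)).1 (by simpa using hQ)
  · exact (reveal_eq_none_iff.1 hzn).1 (by simpa using hQ)

/-! ### The optimum of the current instance -/

/-- The minimum size of a feasible query set for the current instance. -/
def optFrom (I : Input V) (K : Known V) (w : V → ℝ) : ℕ :=
  sInf {n | ∃ Q : Finset V, FeasibleFrom I K w Q ∧ Q.card = n}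

lemma optFrom_le (hQ : FeasibleFrom I K w Q) : optFrom I K w ≤ Q.card :=
  Nat.sInf_le ⟨Q, hQ, rfl⟩

lemma exists_card_eq_optFrom (I : Input V) (K : Known V) (w : V → ℝ) :
    ∃ Q, FeasibleFrom I K w Q ∧ Q.card = optFrom I K w :=
  let ⟨Q, hQ⟩ := exists_feasibleFrom I K w
  Nat.sInf_mem (s := {n | ∃ Q : Finset V, FeasibleFrom I K w Q ∧ Q.card = n}) ⟨_, Q, hQ, rfl⟩

lemma le_optFrom {n : ℕ} (hn : ∀ Q, FeasibleFrom I K w Q → n ≤ Q.card) : n ≤ optFrom I K w := by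
  obtain ⟨Q, hQ, hcard⟩ := exists_card_eq_optFrom I K w
  exact hcard ▸ hn Q hQ

lemma optFrom_reveal_add_le (h : Compatible I K w) {k : ℕ}
    (hP : ∀ Q, FeasibleFrom I K w Q → k ≤ (Q ∩ P).card) :
    optFrom I (K.reveal w P) w + k ≤ optFrom I K w :=
  le_optFrom fun Q hQ => by
    rw [← Finset.card_sdiff_add_card_inter Q P]
    exact Nat.add_le_add (optFrom_le (hQ.sdiff h P)) (hP Q hQ)

lemma optFrom_reveal_le (h : Compatible I K w) (P : Finset V) :
    optFrom I (K.reveal w P) w ≤ optFrom I K w :=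
  optFrom_reveal_add_le h fun _ _ => Nat.zero_le _

lemma Mandatory.optFrom_reveal (hv : Mandatory I K w v) (h : Compatible I K w) :
    optFrom I (K.reveal w {v}) w + 1 ≤ optFrom I K w :=
  optFrom_reveal_add_le h fun Q hQ => Finset.card_pos.2 ⟨v, by simp [hv Q hQ]⟩

lemma WitnessPair.optFrom_reveal (hyz : WitnessPair I K y z) (hE : Exhausted I K)
    (h : Compatible I K w) : optFrom I (K.reveal w {y, z}) w + 1 ≤ optFrom I K w := by
  refine optFrom_reveal_add_le h fun Q hQ => Finset.card_pos.2 ?_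
  rcases hyz.mem_or_mem hE h hQ with hy | hz
  · exact ⟨y, by simp [hy]⟩
  · exact ⟨z, by simp [hz]⟩

lemma optFrom_pos_of_not_solved (hS : S ∈ I.edges) (hn : ¬ Solved I K S) : 0 < optFrom I K w :=
  le_optFrom fun Q hQ => Finset.card_pos.2 <| by
    by_contra hempty
    rw [Finset.not_nonempty_iff_eq_empty] at hempty
    exact hn (by simpa only [hempty, reveal_empty] using hQ S hS)

lemma WitnessPair.optFrom_pos (hyz : WitnessPair I K y z) : 0 < optFrom I K w := by
  obtain ⟨-, S, hS, hn, -⟩ := hyz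
  exact optFrom_pos_of_not_solved hS hn

lemma PredMandatory.optFrom_pos (hv : PredMandatory I K v) (h : Consistent I K) :
    0 < optFrom I K w := by
  obtain ⟨hvn, S, hS, hF⟩ := (predMandatory_iff h).1 hv
  exact optFrom_pos_of_not_solved hS (hF.not_solved h.compatible_guess hvn)

lemma IsMinVertexCover.card_le_optFrom (hQ : IsMinVertexCover (vcGraph I K) Q)
    (hE : Exhausted I K) (h : Compatible I K w) : Q.card ≤ optFrom I K w :=
  le_optFrom fun _ hP => hQ.2 _ fun _ _ hyz => WitnessPair.mem_or_mem hyz hE h hP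

/-! ### Enforced vertices with a single possible witness -/

namespace Consistent

lemma L_le_lowerLimit (h : Consistent I K) (v : V) : I.L v ≤ lowerLimit I K v := by
  rcases hv : K v with _ | b
  · exact (lowerLimit_of_eq_none hv).ge
  · exact (lowerLimit_of_eq_some hv).symm ▸ (h v b hv).1.le

lemma lowerLimit_lt_U (h : Consistent I K) (v : V) : lowerLimit I K v < I.U v := by
  rcases hv : K v with _ | b
  · exact (lowerLimit_of_eq_none hv).symm ▸ I.L_lt_U v
  · exact (lowerLimit_of_eq_some hv).symm ▸ (h v b hv).2

lemma L_lt_upperLimit (h : Consistent I K) (v : V) : I.L v < upperLimit I K v := by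
  rcases hv : K v with _ | b
  · exact (upperLimit_of_eq_none hv).symm ▸ I.L_lt_U v
  · exact (upperLimit_of_eq_some hv).symm ▸ (h v b hv).1

lemma upperLimit_le_U (h : Consistent I K) (v : V) : upperLimit I K v ≤ I.U v := by
  rcases hv : K v with _ | b
  · exact (upperLimit_of_eq_none hv).le
  · exact (upperLimit_of_eq_some hv).symm ▸ (h v b hv).2.le

end Consistent

lemma Solved.of_dominated (hS : Solved I K S) (h : Consistent I K) (h' : Consistent I K')
    (hK : ∀ z ≠ y, K z = K' z) (ha : a ∈ S) (hay : a ≠ y) (hU : I.U a ≤ I.L y) :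
    Solved I K' S := by
  obtain ⟨v, hv, hmin⟩ := solved_iff.1 hS
  have hvy : v ≠ y := by
    rintro rfl
    exact (hmin a ha hay).not_gt
      ((h.lowerLimit_lt_U a).trans_le (hU.trans (h.L_lt_upperLimit v).le))
  refine solved_iff.2 ⟨v, hv, fun z hz hzv => ?_⟩
  have hupper : upperLimit I K' v = upperLimit I K v := by simp only [upperLimit, hK v hvy]
  rcases eq_or_ne z y with rfl | hzy
  · refine hupper.trans_le (le_trans ?_ (hU.trans (h'.L_le_lowerLimit z)))
    rcases eq_or_ne a v with rfl | hav
    · exact h.upperLimit_le_U a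
    · exact (hmin a ha hav).trans (h.lowerLimit_lt_U a).le
  · simpa only [hupper, lowerLimit, hK z hzy] using hmin z hz hzv

lemma exists_U_le_L_of_witnessPair_mem (hE : Exhausted I K) (hE' : Exhausted I (K.reveal w P))
    (h : Compatible I K w) (hy : K y = none) (hP : ∀ z, WitnessPair I K y z → z ∈ P)
    (hS : S ∈ I.edges) (hyS : y ∈ S) (hn : ¬ Solved I (K.reveal w P) S) :
    ∃ a ∈ S, a ≠ y ∧ I.U a ≤ I.L y := by
  have hnK : ¬ Solved I K S := fun hs => hn (hs.reveal h P)
  obtain ⟨a, ha⟩ := exists_leftmost I (K.reveal w P) ⟨y, hyS⟩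
  have haK := ha.of_reveal hE hE' h hS hn
  obtain ⟨haP, han⟩ := reveal_eq_none_iff.1 (ha.eq_none hn)
  have hay : a ≠ y := by
    rintro rfl
    obtain ⟨z, hz, hza, hzn, b, hba, hbz⟩ := hE'.exists_inter hS hn ha
    exact (reveal_eq_none_iff.1 hzn).1 (hP z ⟨hza.symm, S, hS, hnK, hyS, hz,
      ⟨b, h.ival_reveal_subset P a hba, h.ival_reveal_subset P z hbz⟩, Or.inl haK⟩)
  refine ⟨a, ha.1, hay, ?_⟩
  by_contra! hlt
  have hle : I.L a ≤ I.L y := by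
    simpa only [lowerLimit_of_eq_none han, lowerLimit_of_eq_none hy] using haK.2 y hyS
  refine haP (hP a ⟨hay.symm, S, hS, hnK, hyS, ha.1, ?_, Or.inr haK⟩)
  rw [ival_of_eq_none hy, ival_of_eq_none han, Set.Ioo_inter_Ioo, sup_eq_left.2 hle]
  exact Set.nonempty_Ioo.2 (lt_min (I.L_lt_U y) hlt)

lemma FeasibleFrom.erase_of_witnessPair_mem (hQ : FeasibleFrom I (K.reveal w P) w Q)
    (hE : Exhausted I K) (hE' : Exhausted I (K.reveal w P)) (h : Compatible I K w)
    (hy : K y = none) (hP : ∀ z, WitnessPair I K y z → z ∈ P) :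
    FeasibleFrom I (K.reveal w P) w (Q.erase y) := by
  have hK : ∀ z ≠ y, (K.reveal w P).reveal w Q z = (K.reveal w P).reveal w (Q.erase y) z :=
    fun z hz => by simp [Known.reveal, hz]
  intro S hS
  by_cases hyS : y ∈ S
  · by_cases hn : Solved I (K.reveal w P) S
    · exact hn.reveal (h.reveal P) _
    obtain ⟨a, ha, hay, hU⟩ := exists_U_le_L_of_witnessPair_mem hE hE' h hy hP hS hyS hn
    exact (hQ S hS).of_dominated ((h.reveal P).reveal Q).consistent
      ((h.reveal P).reveal _).consistent hK ha hay hU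
  · exact (hQ S hS).congr fun z hz => hK z (ne_of_mem_of_not_mem hz hyS)

/-- If the query of `v` makes no vertex known mandatory, then `y`, whose only possible witness
was `v`, never has to be queried afterwards. -/
lemma WitnessPair.optFrom_reveal_of_unique (hyv : WitnessPair I K y v)
    (hno : ∀ z, WitnessPair I K y z → z = v) (hE : Exhausted I K)
    (hE' : Exhausted I (K.reveal w {v})) (h : Compatible I K w) :
    optFrom I (K.reveal w {v}) w + 1 ≤ optFrom I K w := by
  refine le_optFrom fun Q hQ => (Nat.add_le_add_right (optFrom_le
    ((hQ.sdiff h {v}).erase_of_witnessPair_mem hE hE' h (hyv.eq_none hE).1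
      fun z hz => Finset.mem_singleton.2 (hno z hz))) 1).trans (Finset.card_lt_card ?_)
  refine ⟨(Finset.erase_subset _ _).trans Finset.sdiff_subset, fun hsub => ?_⟩
  rcases hyv.mem_or_mem hE h hQ with hm | hm <;> simpa using hsub hm

/-! ### Hops of the current instance -/

/-- The pairs of unqueried vertices that contribute to the hop distance, listed as (interval,
weight). -/
def activeHops [Fintype V] (I : Input V) (K : Known V) (w : V → ℝ) : Finset (V × V) :=
  Finset.univ.filter fun p => p.1 ≠ p.2 ∧ K p.1 = none ∧ K p.2 = none ∧ Hops I w p.1 p.2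

/-- The hop distance between the predictions and the precise weights, restricted to the vertices
that have not been queried. -/
def hopFrom [Fintype V] (I : Input V) (K : Known V) (w : V → ℝ) : ℕ := (activeHops I K w).card

lemma mem_activeHops [Fintype V] : (v, z) ∈ activeHops I K w ↔
    v ≠ z ∧ K v = none ∧ K z = none ∧ Hops I w v z := by
  simp [activeHops]

lemma activeHops_reveal_subset [Fintype V] (I : Input V) (K : Known V) (w : V → ℝ)
    (P : Finset V) : activeHops I (K.reveal w P) w ⊆ activeHops I K w := by
  rintro ⟨v, z⟩ hp
  simp only [mem_activeHops, reveal_eq_none_iff] at hp ⊢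
  tauto

lemma hopFrom_reveal_le [Fintype V] (I : Input V) (K : Known V) (w : V → ℝ) (P : Finset V) :
    hopFrom I (K.reveal w P) w ≤ hopFrom I K w :=
  Finset.card_le_card (activeHops_reveal_subset I K w P)

lemma hopFrom_reveal_add_one_le [Fintype V] (hp : (v, z) ∈ activeHops I K w)
    (hP : v ∈ P ∨ z ∈ P) : hopFrom I (K.reveal w P) w + 1 ≤ hopFrom I K w := by
  refine Finset.card_lt_card ⟨activeHops_reveal_subset I K w P, fun hsub => ?_⟩
  have := hsub hp
  simp only [mem_activeHops, reveal_eq_none_iff] at this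
  tauto

lemma hopFrom_initial [Fintype V] (I : Input V) (w : V → ℝ) :
    hopFrom I (Known.initial V) w = hopDistance I w := by
  have hsum : ∀ v, (∑ z ∈ Finset.univ.erase v, if Hops I w z v then 1 else 0) =
      ∑ z, if z ≠ v ∧ Hops I w z v then 1 else 0 := fun v => by
    rw [← Finset.filter_ne', Finset.sum_filter]
    exact Finset.sum_congr rfl fun z _ => (ite_and (z ≠ v) (Hops I w z v) 1 0).symm
  simp only [hopFrom, activeHops, Known.initial, hopDistance, hsum, true_and, Finset.card_filter]
  rw [Fintype.sum_prod_type_right]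

lemma not_hops_iff : ¬ Hops I w m z ↔
    (I.L m < I.pred z ↔ I.L m < w z) ∧ (I.pred z < I.U m ↔ w z < I.U m) := by
  unfold Hops
  grind

lemma MustQuery.congr {w' : V → ℝ} (hL : ∀ z ≠ m, (I.L m < w z ↔ I.L m < w' z))
    (hU : ∀ z ≠ m, (w z < I.U m ↔ w' z < I.U m)) : MustQuery I w m ↔ MustQuery I w' m :=
  exists_congr fun _ => and_congr_right fun _ => and_congr_right fun _ =>
    and_congr (forall₃_congr fun z _ hz => hL z hz)
      (exists_congr fun z => and_congr_right fun _ => and_congr_right fun hz => hU z hz)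

lemma exists_hops (h : Compatible I K w)
    (hm : ¬ (MustQuery I (guess I K) m ↔ MustQuery I w m)) :
    ∃ z, m ≠ z ∧ K z = none ∧ Hops I w m z := by
  by_contra! hc
  have hpos : ∀ z ≠ m, (I.L m < guess I K z ↔ I.L m < w z) ∧
      (guess I K z < I.U m ↔ w z < I.U m) := by
    intro z hz
    by_cases hzn : K z = none
    · rw [guess_of_eq_none hzn]
      exact not_hops_iff.1 (hc z hz.symm hzn)
    · simp [guess, h.eq_some hzn]
  exact hm (MustQuery.congr (fun z hz => (hpos z hz).1) fun z hz => (hpos z hz).2)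

lemma Enforces.hops (hyv : Enforces I K y v) (hy : w y ∉ ival I K v) : Hops I w v y := by
  obtain ⟨-, -, hv, hp, -⟩ := hyv
  rw [ival_of_eq_none hv] at hp hy
  by_contra hn
  obtain ⟨hL, hU⟩ := not_hops_iff.1 hn
  exact hy ⟨hL.1 hp.1, hU.1 hp.2⟩

lemma Enforces.hop_mem_activeHops [Fintype V] (hyv : Enforces I K y v) (hy : w y ∉ ival I K v) :
    (v, y) ∈ activeHops I K w :=
  mem_activeHops.2 ⟨hyv.1.symm, hyv.2.2.1, hyv.2.1, hyv.hops hy⟩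

/-- If `v` is not mandatory after all, then some weight hops relative to the interval of `v`, and
this hop is no longer counted once `v` has been queried. -/
lemma PredMandatory.optFrom_add_hopFrom_reveal [Fintype V] (hv : PredMandatory I K v)
    (h : Compatible I K w) :
    optFrom I (K.reveal w {v}) w + hopFrom I (K.reveal w {v}) w + 1 ≤
      optFrom I K w + hopFrom I K w := by
  obtain ⟨hvn, hguess⟩ := (predMandatory_iff h.consistent).1 hv
  by_cases hm : MustQuery I w v
  · have := ((mandatory_iff h).2 ⟨hvn, hm⟩).optFrom_reveal h
    have := hopFrom_reveal_le I K w {v}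
    omega
  · obtain ⟨z, hvz, hzn, hhop⟩ := exists_hops h fun hiff => hm (hiff.1 hguess)
    have := optFrom_reveal_le h {v}
    have := hopFrom_reveal_add_one_le (P := {v})
      (mem_activeHops.2 ⟨hvz, hvn, hzn, hhop⟩) (Or.inl (Finset.mem_singleton_self v))
    omega

/-! ### Counting mandatory vertices -/

/-- The mandatory vertices of the current instance. -/
def mandatorySet [Fintype V] (I : Input V) (K : Known V) (w : V → ℝ) : Finset V :=
  Finset.univ.filter (Mandatory I K w)

lemma mem_mandatorySet [Fintype V] : m ∈ mandatorySet I K w ↔ Mandatory I K w m := by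
  simp [mandatorySet]

lemma card_mandatorySet_le_optFrom [Fintype V] (I : Input V) (K : Known V) (w : V → ℝ) :
    (mandatorySet I K w).card ≤ optFrom I K w :=
  le_optFrom fun Q hQ => Finset.card_le_card fun _ hm => mem_mandatorySet.1 hm Q hQ

lemma mandatorySet_reveal_subset [Fintype V] (h : Compatible I K w) (P : Finset V) :
    mandatorySet I (K.reveal w P) w ⊆ mandatorySet I K w := fun _ hm =>
  mem_mandatorySet.2 fun _ hQ =>
    (Finset.mem_sdiff.1 (mem_mandatorySet.1 hm _ (hQ.sdiff h P))).1

lemma Mandatory.card_mandatorySet_reveal [Fintype V] (hv : Mandatory I K w v)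
    (h : Compatible I K w) :
    (mandatorySet I (K.reveal w {v}) w).card + 1 ≤ (mandatorySet I K w).card := by
  refine Finset.card_lt_card ⟨mandatorySet_reveal_subset h {v}, fun hsub => ?_⟩
  have hv' := mem_mandatorySet.1 (hsub (mem_mandatorySet.2 hv))
  simpa [reveal_eq_none_iff] using ((mandatory_iff (h.reveal {v})).1 hv').1

lemma card_mandatorySet_le_hopFrom [Fintype V] (h : Compatible I K w)
    (hP : ∀ v, ¬ PredMandatory I K v) : (mandatorySet I K w).card ≤ hopFrom I K w := by
  refine Finset.card_le_card_of_surjOn Prod.fst fun m hm => ?_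
  obtain ⟨hmn, hmust⟩ := (mandatory_iff h).1 (mem_mandatorySet.1 hm)
  obtain ⟨z, hmz, hz, hhop⟩ := exists_hops h (m := m) fun hiff =>
    hP m ((predMandatory_iff h.consistent).2 ⟨hmn, hiff.2 hmust⟩)
  exact ⟨(m, z), mem_activeHops.2 ⟨hmz, hmn, hz, hhop⟩, rfl⟩

/-! ### Counting queries -/

section Budget

variable [Fintype V] {g q c d e : ℕ} {s : Stage V}

/-- Upper bounds on the number `c` of remaining queries, with slacks `d` and `e` that settle the
account of earlier queries: the first yields the robustness `g`, the second, multiplied by `g`, the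
consistency `1 + 1 / g`. The subtraction is meant to be truncated, so that no query is made when
the optimum vanishes. -/
structure Budget (I : Input V) (g d e : ℕ) (K : Known V) (w : V → ℝ) (c : ℕ) : Prop where
  robust : c ≤ g * optFrom I K w - d
  consistent : g * c ≤ (g + 1) * (optFrom I K w + hopFrom I K w) + e

lemma Budget.mono (hB : Budget I g d e K w c) {d' e' : ℕ} (hd : d' ≤ d) (he : e ≤ e') :
    Budget I g d' e' K w c :=
  ⟨hB.robust.trans (Nat.sub_le_sub_left hd _), hB.consistent.trans (Nat.add_le_add_left he _)⟩

/-- The accounting rule for `n` queries that lower the optimum by `a` and the sum of optimum and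
hop distance by `b`. -/
lemma Budget.charge (hB : Budget I g d e K' w c) {n d' e' a b : ℕ}
    (ho : optFrom I K' w + a ≤ optFrom I K w)
    (hk : optFrom I K' w + hopFrom I K' w + b ≤ optFrom I K w + hopFrom I K w)
    (hpos : n + d' ≤ g * optFrom I K w) (hd : n + d' ≤ g * a + d)
    (he : g * n + e ≤ (g + 1) * b + e') : Budget I g d' e' K w (c + n) := by
  constructor
  · have hgo := Nat.mul_le_mul_left g ho
    have := hB.robust
    rw [mul_add] at hgo
    omega
  · have hgk := Nat.mul_le_mul_left (g + 1) hk
    have := hB.consistent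
    rw [mul_add] at hgk ⊢
    omega

/-- The account at the test of the repeat loop, known mandatory vertices being queried first. The
query of a known mandatory vertex costs `1` and lowers the optimum, which leaves a surplus of
`g - 1`; without prediction mandatory vertices, the `2`-competitive vertex cover phase leaves a
surplus of `g - 2`. -/
structure TestBound (I : Input V) (g : ℕ) (K : Known V) (w : V → ℝ) (c : ℕ) : Prop where
  budget : Budget I g 0 0 K w c
  budget_of_not_exhausted : ¬ Exhausted I K → Budget I g (g - 1) 0 K w c
  budget_of_forall_not_predMandatory :
    (∀ v, ¬ PredMandatory I K v) → Budget I g (g - 2) 0 K w c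

/-- The bounds on the number `c` of queries that are made from the given control state onwards.
The algorithm never reaches the stages that are left unconstrained. -/
def StageBound (I : Input V) (g : ℕ) (w : V → ℝ) (K : Known V) (c : ℕ) : Stage V → Prop
  | .exhaust (.collect q) => q + 2 ≤ g → Budget I g q q K w c
  | .collect q => Exhausted I K → q + 2 ≤ g → Budget I g q q K w c
  | .pairs => Exhausted I K → Budget I g (g - 2) (g - 2) K w c ∧
      ((∀ v, ¬ PredMandatory I K v) → Budget I g (g - 2) 0 K w c)
  | .single v => ∃ c', c = c' + 1 ∧ TestBound I g (K.reveal w {v}) w c'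
  | .exhaust .test => TestBound I g K w c
  | .test => Exhausted I K → TestBound I g K w c
  | .cover => Exhausted I K → (∀ v, ¬ PredMandatory I K v) →
      c ≤ 2 * optFrom I K w ∧ c ≤ optFrom I K w + hopFrom I K w
  | .sweep C => c ≤ C.card + (mandatorySet I (K.reveal w C) w).card
  | .exhaust .finish => c ≤ (mandatorySet I K w).card
  | .finish => c = 0
  | _ => True

namespace StageBound

lemma exhaust_query (hg : 2 ≤ g) (h : Compatible I K w) (hv : KnownMandatory I K v)
    (hB : StageBound I g w (K.reveal w {v}) c (.exhaust s)) :
    StageBound I g w K (c + 1) (.exhaust s) := by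
  have hm := hv.mandatory h
  have hopt := hm.optFrom_reveal h
  have hhop := hopFrom_reveal_le I K w {v}
  have hgo : g ≤ g * optFrom I K w := Nat.le_mul_of_pos_right g (by omega)
  cases s with
  | collect q =>
    intro hq
    exact (hB hq).charge (n := 1) (b := 1) hopt (by omega) (by omega) (by omega) (by omega)
  | test =>
    have hsurplus : Budget I g (g - 1) 0 K w (c + 1) :=
      hB.budget.charge (n := 1) (b := 1) hopt (by omega) (by omega) (by omega) (by omega)
    exact ⟨hsurplus.mono (by omega) le_rfl, fun _ => hsurplus,
      fun _ => hsurplus.mono (by omega) le_rfl⟩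
  | finish => exact (Nat.add_le_add_right hB 1).trans (hm.card_mandatorySet_reveal h)
  | _ => trivial

lemma exhaust_done (hE : Exhausted I K) (hB : StageBound I g w K c s) :
    StageBound I g w K c (.exhaust s) := by
  cases s with
  | collect q => exact hB hE
  | test => exact hB hE
  | finish => exact hB.trans_le (Nat.zero_le _)
  | _ => trivial

lemma collect_query (h : Compatible I K w) (hq : q + 2 < g) (hv : PredMandatory I K v)
    (hB : StageBound I g w (K.reveal w {v}) c (.exhaust (.collect (q + 1)))) :
    StageBound I g w K (c + 1) (.collect q) := by
  intro _ _
  have hgo : g ≤ g * optFrom I K w := Nat.le_mul_of_pos_right g (hv.optFrom_pos h.consistent)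
  exact (hB hq).charge (n := 1) (a := 0) (b := 1) (optFrom_reveal_le h {v})
    (hv.optFrom_add_hopFrom_reveal h) (by omega) (by omega) (by omega)

lemma collect_done (hq : g ≤ q + 2 ∨ ∀ v, ¬ PredMandatory I K v)
    (hB : StageBound I g w K c .pairs) : StageBound I g w K c (.collect q) := by
  intro hE hqg
  obtain ⟨hpairs, hexit⟩ := hB hE
  rcases hq with hq | hq
  · exact hpairs.mono (by omega) (by omega)
  · exact (hexit hq).mono (by omega) (Nat.zero_le q)

lemma pairs_triple_in (hg : 2 ≤ g) (h : Compatible I K w) (hv : Enforces I K y v)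
    (hz : WitnessPair I K y z) (hvz : v ≠ z) (hE : Exhausted I K) (hy : w y ∈ ival I K v)
    (hB : StageBound I g w (K.reveal w {y, z}) c (.single v)) :
    Budget I g (g - 2) (g - 2) K w (c + 2) := by
  obtain ⟨c, rfl, hT⟩ := hB
  have hm : Mandatory I (K.reveal w {y, z}) w v :=
    (hv.mandatory hE h hy).reveal (by simp [hv.1.symm, hvz])
  have hyz := hz.optFrom_reveal hE h
  have hopt := hm.optFrom_reveal (h.reveal {y, z})
  have hhop := (hopFrom_reveal_le I (K.reveal w {y, z}) w {v}).trans
    (hopFrom_reveal_le I K w {y, z})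
  have hgo : g * 2 ≤ g * optFrom I K w := Nat.mul_le_mul_left g (by omega)
  exact hT.budget.charge (n := 3) (a := 2) (b := 2) (by omega) (by omega) (by omega) (by omega)
    (by omega)

lemma pairs_triple_out (hg : 2 ≤ g) (h : Compatible I K w) (hv : Enforces I K y v)
    (hz : WitnessPair I K y z) (hE : Exhausted I K) (hy : w y ∉ ival I K v)
    (hB : StageBound I g w (K.reveal w {y, z}) c (.exhaust .test)) :
    Budget I g (g - 2) (g - 2) K w (c + 2) := by
  have hopt := hz.optFrom_reveal hE h
  have hhop := hopFrom_reveal_add_one_le (P := {y, z}) (hv.hop_mem_activeHops hy)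
    (Or.inr (Finset.mem_insert_self y {z}))
  have hgo : g ≤ g * optFrom I K w := Nat.le_mul_of_pos_right g (by omega)
  exact hB.budget.charge (n := 2) (b := 2) hopt (by omega) (by omega) (by omega) (by omega)

lemma pairs_triple (hg : 2 ≤ g) (h : Compatible I K w) (hv : Enforces I K y v)
    (hz : WitnessPair I K y z) (hvz : v ≠ z)
    (hin : w y ∈ ival I K v → StageBound I g w (K.reveal w {y, z}) c (.single v))
    (hout : w y ∉ ival I K v → StageBound I g w (K.reveal w {y, z}) c (.exhaust .test)) :
    StageBound I g w K (c + 2) .pairs := by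
  intro hE
  refine ⟨?_, fun hP => absurd (hv.predMandatory hE h.consistent) (hP v)⟩
  by_cases hy : w y ∈ ival I K v
  · exact pairs_triple_in hg h hv hz hvz hE hy (hin hy)
  · exact pairs_triple_out hg h hv hz hE hy (hout hy)

lemma pairs_pair (hg : 2 ≤ g) (h : Compatible I K w) (hno : ∀ z, WitnessPair I K y z → z = v)
    (hv : Enforces I K y v) (hB : StageBound I g w K c (.single v)) :
    StageBound I g w K c .pairs := by
  intro hE
  obtain ⟨c, rfl, hT⟩ := hB
  have hpred := hv.predMandatory hE h.consistent
  have hpot := hpred.optFrom_add_hopFrom_reveal h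
  have hgo : g ≤ g * optFrom I K w := Nat.le_mul_of_pos_right g hv.witnessPair.optFrom_pos
  refine ⟨?_, fun hP => absurd hpred (hP v)⟩
  by_cases hE' : Exhausted I (K.reveal w {v})
  · exact hT.budget.charge (n := 1) (b := 1)
      (hv.witnessPair.optFrom_reveal_of_unique hno hE hE' h) hpot (by omega) (by omega) (by omega)
  · exact (hT.budget_of_not_exhausted hE').charge (n := 1) (a := 0) (b := 1)
      (optFrom_reveal_le h {v}) hpot (by omega) (by omega) (by omega)

lemma pairs_none (h : Consistent I K) (hno : ∀ y v, ¬ Enforces I K y v)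
    (hB : StageBound I g w K c (.exhaust .test)) : StageBound I g w K c .pairs := by
  intro hE
  have hexit := hB.budget_of_forall_not_predMandatory fun v hv => by
    obtain ⟨y, v', hyv⟩ := hv.exists_enforces hE h
    exact hno y v' hyv
  exact ⟨hexit.mono le_rfl (Nat.zero_le _), fun _ => hexit⟩

lemma test_repeat (hg : 2 ≤ g) (hv : PredMandatory I K v)
    (hB : StageBound I g w K c (.collect 0)) : StageBound I g w K c .test := fun hE =>
  ⟨hB hE hg, fun hn => absurd hE hn, fun hP => absurd hv (hP v)⟩

lemma test_exit (hg : 2 ≤ g) (hP : ∀ v, ¬ PredMandatory I K v)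
    (hB : StageBound I g w K c .cover) : StageBound I g w K c .test := by
  intro hE
  obtain ⟨hrobust, hconsistent⟩ := hB hE hP
  have hexit : Budget I g (g - 2) 0 K w c := by
    refine ⟨?_, Nat.mul_le_mul g.le_succ hconsistent⟩
    obtain ⟨d, rfl⟩ := Nat.exists_eq_add_of_le hg
    rcases Nat.eq_zero_or_pos (optFrom I K w) with hzero | hpos
    · omega
    · have := Nat.le_mul_of_pos_right d hpos
      rw [add_mul]
      omega
  exact ⟨hexit.mono (Nat.zero_le _) le_rfl, fun hn => absurd hE hn, fun _ => hexit⟩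

lemma cover (h : Compatible I K w) (hQ : IsMinVertexCover (vcGraph I K) Q)
    (hB : StageBound I g w K c (.sweep Q)) : StageBound I g w K c .cover := by
  intro hE hP
  have hcover := hQ.card_le_optFrom hE h
  have hsub := Finset.card_le_card (mandatorySet_reveal_subset h Q)
  have hopt := card_mandatorySet_le_optFrom I K w
  have hhop := card_mandatorySet_le_hopFrom h hP
  simp only [StageBound] at hB
  omega

lemma sweep_query (hv : v ∈ Q) (hB : StageBound I g w (K.update v (w v)) c (.sweep (Q.erase v))) :
    StageBound I g w K (c + 1) (.sweep Q) := by
  simp only [StageBound, reveal_update, Finset.insert_erase hv] at hB ⊢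
  have := Finset.card_erase_add_one hv
  omega

lemma sweep_done (hB : StageBound I g w K c (.exhaust .finish)) :
    StageBound I g w K c (.sweep ∅) := by
  simpa only [StageBound, reveal_empty, Finset.card_empty, zero_add] using hB

end StageBound

theorem Follows.stageBound {t : QueryTree V} (hg : 2 ≤ g) (hF : Follows I g s K t)
    (h : Compatible I K w) : StageBound I g w K (t.run w).length s := by
  have hw := h.realization
  induction hF with
  | exhaust_query v _ hv _ ih =>
    exact .exhaust_query hg h hv (update_eq_reveal _ w v ▸ ih _ (hw v) (h.update v))
  | exhaust_done hE _ ih => exact .exhaust_done hE (ih h)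
  | collect_query v _ hq hv _ ih =>
    exact .collect_query h hq hv (update_eq_reveal _ w v ▸ ih _ (hw v) (h.update v))
  | collect_done hq _ ih => exact .collect_done hq (ih h)
  | pairs_triple y v z _ hv hz hvz _ _ ihin ihout =>
    have h' := (h.update y).update z
    exact .pairs_triple hg h hv hz hvz
      (fun hy => update_update_eq_reveal _ w y z ▸ ihin _ (hw y) _ (hw z) hy h')
      (fun hy => update_update_eq_reveal _ w y z ▸ ihout _ (hw y) _ (hw z) hy h')
  | pairs_pair y v hno hv _ ih =>
    exact .pairs_pair hg h (fun z hz => (hno y v z hv hz).symm) hv (ih h)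
  | pairs_none hno _ ih => exact .pairs_none h.consistent hno (ih h)
  | single_query v _ _ ih => exact ⟨_, rfl, update_eq_reveal _ w v ▸ ih _ (hw v) (h.update v)⟩
  | test_repeat v hv _ ih => exact .test_repeat hg hv (ih h)
  | test_exit hP _ ih => exact .test_exit hg hP (ih h)
  | cover C hC _ ih => exact .cover h hC (ih h)
  | sweep_query v _ hv _ ih => exact .sweep_query hv (ih _ (hw v) (h.update v))
  | sweep_done _ ih => exact .sweep_done (ih h)
  | finish => rfl

end Budget

/-! ### Feasibility -/

/-- Whatever is queried next, no hyperedge is unsolved once there is no known mandatory vertex. -/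
def Settled (I : Input V) (K : Known V) (w : V → ℝ) : Prop :=
  ∀ Q : Finset V, Exhausted I (K.reveal w Q) → ∀ S ∈ I.edges, Solved I (K.reveal w Q) S

/-- The invariant of the control states that leads to a feasible set of queries. The states
`exhaust s` with `s` other than `collect q`, `test` and `finish` do not occur in the algorithm. -/
def StageReady (I : Input V) (w : V → ℝ) (K : Known V) : Stage V → Prop
  | .exhaust .finish => Settled I K w
  | .exhaust (.collect _) => True
  | .exhaust .test => True
  | .exhaust _ => False
  | .collect _ => Exhausted I K
  | .pairs => Exhausted I K
  | .single _ => True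
  | .test => Exhausted I K
  | .cover => Exhausted I K
  | .sweep C => Settled I (K.reveal w C) w
  | .finish => Settled I K w ∧ Exhausted I K

lemma Settled.reveal (h : Settled I K w) (P : Finset V) : Settled I (K.reveal w P) w :=
  fun Q => by simpa only [reveal_reveal] using h (P ∪ Q)

lemma Settled.solved (h : Settled I K w) (hE : Exhausted I K) (hS : S ∈ I.edges) :
    Solved I K S := by
  simpa only [reveal_empty] using h ∅ (by rwa [reveal_empty]) S hS

lemma settled_reveal_of_isVertexCover (hE : Exhausted I K) (h : Compatible I K w)
    (hC : (vcGraph I K).IsVertexCover (P : Set V)) : Settled I (K.reveal w P) w := by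
  intro Q hE' S hS
  rw [reveal_reveal] at hE' ⊢
  exact solved_reveal_of_isVertexCover hE hE' h
    (hC.subset (Finset.coe_subset.2 Finset.subset_union_left)) hS

lemma StageReady.exhaust_update {s : Stage V} (hs : StageReady I w K (.exhaust s)) (v : V) :
    StageReady I w (K.update v (w v)) (.exhaust s) := by
  cases s with
  | finish => exact update_eq_reveal K w v ▸ Settled.reveal hs {v}
  | _ => exact hs

lemma StageReady.of_exhaust {s : Stage V} (hs : StageReady I w K (.exhaust s))
    (hE : Exhausted I K) : StageReady I w K s := by
  cases s with
  | finish => exact ⟨hs, hE⟩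
  | collect | test => exact hE
  | _ => exact hs.elim

lemma StageReady.sweep_update (hs : StageReady I w K (.sweep P)) (hv : v ∈ P) :
    StageReady I w (K.update v (w v)) (.sweep (P.erase v)) := by
  simpa only [StageReady, reveal_update, Finset.insert_erase hv] using hs

lemma feasibleFrom_run_query {next : ℝ → QueryTree V}
    (h : FeasibleFrom I (K.update v (w v)) w ((next (w v)).run w).toFinset) :
    FeasibleFrom I K w ((QueryTree.query v next).run w).toFinset := by
  rw [QueryTree.run, List.toFinset_cons]
  rwa [update_eq_reveal, feasibleFrom_reveal_iff, Finset.singleton_union] at h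

theorem Follows.feasibleFrom {g : ℕ} {s : Stage V} {t : QueryTree V} (hF : Follows I g s K t)
    (h : Compatible I K w) (hs : StageReady I w K s) :
    FeasibleFrom I K w (t.run w).toFinset := by
  have hw := h.realization
  induction hF with
  | exhaust_query v _ _ _ ih =>
    exact feasibleFrom_run_query (ih _ (hw v) (h.update v) (hs.exhaust_update v))
  | exhaust_done hE _ ih => exact ih h (hs.of_exhaust hE)
  | collect_query v _ _ _ _ ih =>
    exact feasibleFrom_run_query (ih _ (hw v) (h.update v) trivial)
  | collect_done _ _ ih => exact ih h hs
  | @pairs_triple K y v z next _ _ _ _ _ ihin ihout =>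
    have h' := (h.update y).update z
    refine feasibleFrom_run_query (next := fun x => .query z (next x))
      (feasibleFrom_run_query (next := next (w y)) ?_)
    by_cases hy : w y ∈ ival I K v
    · exact ihin _ (hw y) _ (hw z) hy h' trivial
    · exact ihout _ (hw y) _ (hw z) hy h' trivial
  | pairs_pair _ _ _ _ _ ih => exact ih h trivial
  | pairs_none _ _ ih => exact ih h trivial
  | single_query v _ _ ih => exact feasibleFrom_run_query (ih _ (hw v) (h.update v) trivial)
  | test_repeat _ _ _ ih => exact ih h hs
  | test_exit _ _ ih => exact ih h hs
  | cover _ hC _ ih => exact ih h (settled_reveal_of_isVertexCover hs h hC.1)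
  | sweep_query v _ hv _ ih =>
    exact feasibleFrom_run_query (ih _ (hw v) (h.update v) (hs.sweep_update hv))
  | sweep_done _ ih => exact ih h (by simpa only [StageReady, reveal_empty] using hs)
  | finish => exact fun S hS => by simpa [QueryTree.run, reveal_empty] using hs.1.solved hs.2 hS

/-! ### Existence of implementations -/

instance : Inhabited (QueryTree V) := ⟨.halt⟩

/-- The algorithm can be carried out from the control state `s` on, whatever the answers are. -/
def Runs (I : Input V) (g : ℕ) (s : Stage V) (K : Known V) : Prop := ∃ t, Follows I g s K t

section Existence

variable {g : ℕ} {s : Stage V}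

/-- The number of vertices that have not been queried, on which the constructions recurse. -/
def unqueried (K : Known V) : ℕ := {v | K v = none}.ncard

lemma unqueried_update (K : Known V) (v : V) (x : ℝ) :
    unqueried (K.update v x) = ({z | K z = none} \ {v}).ncard := by
  rw [unqueried]
  congr 1
  ext z
  simp only [Set.mem_sdiff, Set.mem_ofPred_eq, Set.mem_singleton_iff,
    update_eq_reveal K (fun _ => x), reveal_eq_none_iff, Finset.mem_singleton, and_comm]

lemma unqueried_update_le (K : Known V) (v : V) (x : ℝ) :
    unqueried (K.update v x) ≤ unqueried K :=
  (unqueried_update K v x).trans_le (Set.ncard_sdiff_singleton_le _ _)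

/-- The loop of the algorithm can be carried out from every consistent state with fewer unqueried
vertices than `K`; the induction hypothesis for its termination. -/
def RunsBelow (I : Input V) (g : ℕ) (K : Known V) : Prop :=
  ∀ K' : Known V, Consistent I K' → unqueried K' < unqueried K →
    (∀ q, Runs I g (.exhaust (.collect q)) K') ∧ Runs I g (.exhaust .test) K'

lemma RunsBelow.single (hR : RunsBelow I g K) (h' : Consistent I K')
    (hlt : ∀ x, unqueried (K'.update v x) < unqueried K) : Runs I g (.single v) K' := by
  have hnext : ∀ x ∈ Set.Ioo (I.L v) (I.U v), Runs I g (.exhaust .test) (K'.update v x) :=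
    fun x hx => (hR _ (h'.update hx) (hlt x)).2
  choose! next hnext using hnext
  exact ⟨_, .single_query v next hnext⟩

variable [Finite V]

lemma unqueried_update_lt (hv : K v = none) (x : ℝ) :
    unqueried (K.update v x) < unqueried K :=
  (unqueried_update K v x).trans_lt (Set.ncard_sdiff_singleton_lt_of_mem hv)

lemma exists_isMinVertexCover (G : SimpleGraph V) : ∃ C, IsMinVertexCover G C :=
  have hcover : G.IsVertexCover ((Set.finite_univ (α := V)).toFinset : Set V) := by simp
  Set.exists_min_image {C : Finset V | G.IsVertexCover (C : Set V)} Finset.card (Set.toFinite _)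
    ⟨_, hcover⟩

lemma runs_exhaust (h : Consistent I K)
    (hs : ∀ K' : Known V, Consistent I K' → unqueried K' ≤ unqueried K → Exhausted I K' →
      Runs I g s K') : Runs I g (.exhaust s) K := by
  induction hk : unqueried K using Nat.strong_induction_on generalizing K with
  | _ k ih =>
    subst hk
    by_cases hE : Exhausted I K
    · obtain ⟨t, ht⟩ := hs K h le_rfl hE
      exact ⟨t, .exhaust_done hE ht⟩
    · obtain ⟨v, hv⟩ := not_forall_not.1 hE
      have hlt := unqueried_update_lt hv.eq_none
      have hnext : ∀ x ∈ Set.Ioo (I.L v) (I.U v), Runs I g (.exhaust s) (K.update v x) :=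
        fun x hx => ih _ (hlt x) (h.update hx)
          (fun K' h' hle => hs K' h' (hle.trans (hlt x).le)) rfl
      choose! next hnext using hnext
      exact ⟨_, .exhaust_query v next hv hnext⟩

lemma runs_sweep (h : Consistent I K) (P : Finset V) : Runs I g (.sweep P) K := by
  induction hP : P.card generalizing P K with
  | zero =>
    obtain rfl := Finset.card_eq_zero.1 hP
    obtain ⟨t, ht⟩ := runs_exhaust (g := g) (s := .finish) h fun _ _ _ _ => ⟨_, .finish⟩
    exact ⟨t, .sweep_done ht⟩
  | succ k ih =>
    obtain ⟨v, hv⟩ := Finset.card_pos.1 (k.succ_pos.trans_eq hP.symm)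
    have hnext : ∀ x ∈ Set.Ioo (I.L v) (I.U v),
        Runs I g (.sweep (P.erase v)) (K.update v x) := fun x hx =>
      ih (h.update hx) _ (by rw [Finset.card_erase_of_mem hv, hP, Nat.add_sub_cancel])
    choose! next hnext using hnext
    exact ⟨_, .sweep_query v next hv hnext⟩

lemma runs_cover (h : Consistent I K) : Runs I g .cover K := by
  obtain ⟨C, hC⟩ := exists_isMinVertexCover (vcGraph I K)
  obtain ⟨t, ht⟩ := runs_sweep (g := g) h C
  exact ⟨t, .cover C hC ht⟩

namespace RunsBelow

lemma pairs_of_witnessPair (hR : RunsBelow I g K) (h : Consistent I K) (hyv : Enforces I K y v)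
    (hyz : WitnessPair I K y z) (hvz : v ≠ z) : Runs I g .pairs K := by
  have hlt : ∀ x x', unqueried ((K.update y x).update z x') < unqueried K := fun x x' =>
    (unqueried_update_le _ z x').trans_lt (unqueried_update_lt hyv.2.1 x)
  have hnext : ∀ x ∈ Set.Ioo (I.L y) (I.U y), ∀ x' ∈ Set.Ioo (I.L z) (I.U z), ∃ t,
      (x ∈ ival I K v → Follows I g (.single v) ((K.update y x).update z x') t) ∧
      (x ∉ ival I K v → Follows I g (.exhaust .test) ((K.update y x).update z x') t) := by
    intro x hx x' hx'
    have h' := (h.update hx).update hx'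
    by_cases hxv : x ∈ ival I K v
    · obtain ⟨t, ht⟩ := hR.single h' fun b => (unqueried_update_le _ v b).trans_lt (hlt x x')
      exact ⟨t, fun _ => ht, absurd hxv⟩
    · obtain ⟨t, ht⟩ := (hR _ h' (hlt x x')).2
      exact ⟨t, fun hc => absurd hc hxv, fun _ => ht⟩
  choose! next hnext using hnext
  exact ⟨_, .pairs_triple y v z next hyv hyz hvz
    (fun x hx x' hx' => (hnext x hx x' hx').1) (fun x hx x' hx' => (hnext x hx x' hx').2)⟩

lemma pairs_of_enforces (hR : RunsBelow I g K) (h : Consistent I K) (hyv : Enforces I K y v) :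
    Runs I g .pairs K := by
  by_cases hno : ∀ y v z, Enforces I K y v → WitnessPair I K y z → v = z
  · obtain ⟨t, ht⟩ := hR.single h (unqueried_update_lt hyv.2.2.1)
    exact ⟨t, .pairs_pair y v hno hyv ht⟩
  · push Not at hno
    obtain ⟨y', v', z, hyv', hyz, hvz⟩ := hno
    exact hR.pairs_of_witnessPair h hyv' hyz hvz

lemma collect_of_predMandatory {q : ℕ} (hR : RunsBelow I g K) (h : Consistent I K)
    (hE : Exhausted I K) (hv : PredMandatory I K v) : Runs I g (.collect q) K := by
  by_cases hq : q + 2 < g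
  · have hvn : K v = none := ((predMandatory_iff h).1 hv).1
    have hnext : ∀ x ∈ Set.Ioo (I.L v) (I.U v),
        Runs I g (.exhaust (.collect (q + 1))) (K.update v x) :=
      fun x hx => (hR _ (h.update hx) (unqueried_update_lt hvn x)).1 (q + 1)
    choose! next hnext using hnext
    exact ⟨_, .collect_query v next hq hv hnext⟩
  · obtain ⟨y, v', hyv⟩ := hv.exists_enforces hE h
    obtain ⟨t, ht⟩ := hR.pairs_of_enforces h hyv
    exact ⟨t, .collect_done (Or.inl (not_lt.1 hq)) ht⟩

lemma test (hR : RunsBelow I g K) (h : Consistent I K) (hE : Exhausted I K) :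
    Runs I g .test K := by
  by_cases hP : ∃ v, PredMandatory I K v
  · obtain ⟨v, hv⟩ := hP
    obtain ⟨t, ht⟩ := hR.collect_of_predMandatory (q := 0) h hE hv
    exact ⟨t, .test_repeat v hv ht⟩
  · obtain ⟨t, ht⟩ := runs_cover (g := g) h
    exact ⟨t, .test_exit (not_exists.1 hP) ht⟩

lemma collect (hR : RunsBelow I g K) (h : Consistent I K) (hE : Exhausted I K) (q : ℕ) :
    Runs I g (.collect q) K := by
  by_cases hP : ∃ v, PredMandatory I K v
  · obtain ⟨v, hv⟩ := hP
    exact hR.collect_of_predMandatory h hE hv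
  · obtain ⟨t, ht⟩ := hR.test h hE
    have hno : ∀ y v, ¬ Enforces I K y v := fun y v hyv => hP ⟨v, hyv.predMandatory hE h⟩
    exact ⟨t, .collect_done (Or.inr (not_exists.1 hP))
      (.pairs_none hno (.exhaust_done hE ht))⟩

end RunsBelow

lemma runsBelow (I : Input V) (g : ℕ) (K : Known V) : RunsBelow I g K := by
  induction hk : unqueried K using Nat.strong_induction_on generalizing K with
  | _ k ih =>
    subst hk
    intro K' h' hlt
    have hR : ∀ K'' : Known V, unqueried K'' ≤ unqueried K' → RunsBelow I g K'' :=
      fun K'' hle => ih _ (hle.trans_lt hlt) _ rfl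
    exact ⟨fun q => runs_exhaust h' fun K'' h'' hle hE => (hR K'' hle).collect h'' hE q,
      runs_exhaust h' fun K'' h'' hle hE => (hR K'' hle).test h'' hE⟩

end Existence

theorem exists_implements (g : ℕ) : ∃ A : DetAlg.{u}, Implements g A := by
  have hruns : ∀ (V : Type u) [Fintype V] (I : Input V),
      Runs I g (.exhaust (.collect 0)) (Known.initial V) := fun V _ I =>
    runs_exhaust (consistent_initial I) fun K h _ hE => (runsBelow I g K).collect h hE 0
  exact ⟨fun V _ I => (hruns V I).choose, fun V _ I => (hruns V I).choose_spec⟩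

/-! ### Competitive ratio -/

/-- The mean of `F` at the random rounding of `γ` that `roundRandomly` uses. -/
def roundingMean (γ : ℝ) (F : ℕ → ℝ) : ℝ :=
  Int.fract γ * F ⌈γ⌉₊ + (1 - Int.fract γ) * F ⌊γ⌋₊

/-- The amount `ξ` by which the mean of `1 / g` at a random rounding `g` of `γ` exceeds `1 / γ`. -/
def roundingExcess (γ : ℝ) : ℝ := roundingMean γ (fun g => 1 / g) - 1 / γ

section Rounding

variable {γ : ℝ}

lemma roundingMean_mono {F G : ℕ → ℝ} {k : ℕ} (hk : k ≤ γ) (h : ∀ g, k ≤ g → F g ≤ G g) :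
    roundingMean γ F ≤ roundingMean γ G :=
  have hfloor : k ≤ ⌊γ⌋₊ := Nat.le_floor hk
  add_le_add
    (mul_le_mul_of_nonneg_left (h _ (hfloor.trans (Nat.floor_le_ceil γ))) (Int.fract_nonneg γ))
    (mul_le_mul_of_nonneg_left (h _ hfloor) (sub_nonneg.2 (Int.fract_lt_one γ).le))

lemma floor_add_fract (hγ : 0 ≤ γ) : (⌊γ⌋₊ : ℝ) + Int.fract γ = γ := by
  rw [natCast_floor_eq_intCast_floor hγ]
  exact Int.floor_add_fract γ

lemma roundingMean_eq (hγ : 0 ≤ γ) (F : ℕ → ℝ) :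
    roundingMean γ F = Int.fract γ * F (⌊γ⌋₊ + 1) + (1 - Int.fract γ) * F ⌊γ⌋₊ := by
  rcases (Int.fract_nonneg γ).eq_or_lt with h | h
  · simp [roundingMean, ← h]
  · have hlt : ⌊γ⌋₊ < ⌈γ⌉₊ := Nat.lt_ceil.2 (by linarith [floor_add_fract hγ])
    rw [roundingMean, (Nat.ceil_le_floor_add_one γ).antisymm hlt]

lemma roundingMean_natCast_mul (hγ : 0 ≤ γ) (T : ℝ) :
    roundingMean γ (fun g => g * T) = γ * T := by
  rw [roundingMean_eq hγ]
  push_cast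
  linear_combination T * floor_add_fract hγ

lemma roundingMean_one_add_inv_mul (γ T : ℝ) :
    roundingMean γ (fun g => (1 + 1 / g) * T) = (1 + 1 / γ + roundingExcess γ) * T := by
  unfold roundingExcess roundingMean
  ring

lemma roundingExcess_eq (hγ : 1 ≤ γ) : roundingExcess γ =
    Int.fract γ * (1 - Int.fract γ) / (⌊γ⌋₊ * (⌊γ⌋₊ + 1) * γ) := by
  have hn : (1 : ℝ) ≤ ⌊γ⌋₊ := by exact_mod_cast Nat.le_floor (by exact_mod_cast hγ)
  have hf : Int.fract γ = γ - ⌊γ⌋₊ := eq_sub_of_add_eq' (floor_add_fract (by linarith))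
  rw [roundingExcess, roundingMean_eq (by linarith), hf]
  push_cast
  field_simp
  ring

lemma roundingExcess_mem (hγ : 2 ≤ γ) : roundingExcess γ ∈ Set.Icc 0 (1 / 48) := by
  have hn : (2 : ℝ) ≤ ⌊γ⌋₊ := by exact_mod_cast Nat.le_floor (by exact_mod_cast hγ)
  rw [roundingExcess_eq (by linarith)]
  set n : ℝ := (⌊γ⌋₊ : ℝ)
  set f := Int.fract γ
  have hnum0 : 0 ≤ f * (1 - f) :=
    mul_nonneg (Int.fract_nonneg γ) (sub_nonneg.2 (Int.fract_lt_one γ).le)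
  have hnum : f * (1 - f) ≤ 1 / 4 := by nlinarith [sq_nonneg (2 * f - 1)]
  have hden : 2 * 3 * 2 ≤ n * (n + 1) * γ := by
    gcongr
    linarith
  refine ⟨by positivity, ?_⟩
  calc f * (1 - f) / (n * (n + 1) * γ) ≤ (1 / 4) / (2 * 3 * 2) := by gcongr
    _ = 1 / 48 := by norm_num

end Rounding

lemma expectedQueries_map {α : Type*} [Fintype α] (p : PMF α) (f : α → DetAlg.{u}) [Fintype V]
    (I : Input V) (w : V → ℝ) : RandAlg.expectedQueries (p.map f) I w =
      ∑ a, p a * (((f a V I).run w).length : ℝ≥0∞) := by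
  simp only [RandAlg.expectedQueries, PMF.map_apply, tsum_fintype, Finset.sum_mul]
  rw [Summable.tsum_finsetSum fun _ _ => ENNReal.summable]
  refine Finset.sum_congr rfl fun a _ => ?_
  rw [tsum_eq_single (f a) fun b hb => by simp [hb]]
  simp

lemma expectedQueries_roundRandomly (A : ℕ → DetAlg.{u}) (γ : ℝ) [Fintype V] (I : Input V)
    (w : V → ℝ) : (roundRandomly A γ).expectedQueries I w =
      ENNReal.ofReal (roundingMean γ fun g => ((A g V I).run w).length) := by
  have h0 := Int.fract_nonneg γ
  have h1 : 0 ≤ 1 - Int.fract γ := sub_nonneg.2 (Int.fract_lt_one γ).le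
  rw [roundRandomly, expectedQueries_map, roundingMean, ENNReal.ofReal_add (by positivity)
    (by positivity), ENNReal.ofReal_mul h0, ENNReal.ofReal_mul h1]
  simp [fractCoin]

namespace Implements

variable {g : ℕ} {A : DetAlg.{u}}

lemma feasible (hA : Implements g A) [Fintype V] (hw : IsRealization I w) :
    Feasible I w ((A V I).run w).toFinset :=
  (hA V I).feasibleFrom hw.compatible_initial trivial

lemma budget (hA : Implements g A) (hg : 2 ≤ g) [Fintype V] (hw : IsRealization I w) :
    Budget I g 0 0 (Known.initial V) w ((A V I).run w).length :=
  (hA V I).stageBound hg hw.compatible_initial hg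

lemma length_le_mul_optCard (hA : Implements g A) (hg : 2 ≤ g) [Fintype V]
    (hw : IsRealization I w) : (((A V I).run w).length : ℝ) ≤ g * optCard I w := by
  exact_mod_cast (hA.budget hg hw).robust

lemma length_le_mul_optCard_add_hopDistance (hA : Implements g A) (hg : 2 ≤ g) [Fintype V]
    (hw : IsRealization I w) :
    (((A V I).run w).length : ℝ) ≤ (1 + 1 / g) * (optCard I w + hopDistance I w) := by
  have hconsistent : g * ((A V I).run w).length ≤ (g + 1) * (optCard I w + hopDistance I w) :=
    hopFrom_initial I w ▸ (hA.budget hg hw).consistent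
  have hpos : (0 : ℝ) < g := by exact_mod_cast (Nat.zero_lt_two.trans_le hg)
  rw [one_add_div hpos.ne', div_mul_eq_mul_div, le_div_iff₀ hpos, mul_comm]
  exact_mod_cast hconsistent

end Implements

lemma achievesRatio_roundRandomly {γ : ℝ} (hγ : 2 ≤ γ) {A : ℕ → DetAlg.{u}}
    (hA : ∀ g, 2 ≤ g → Implements g (A g)) :
    (roundRandomly A γ).AchievesRatio fun _ _ I w =>
      min ((1 + 1 / γ + roundingExcess γ) *
        (1 + (hopDistance I w : ℝ) / (optCard I w : ℝ))) γ := by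
  intro V _ I w hw
  refine ⟨fun a ha => ?_, ?_⟩
  · obtain ⟨b, -, rfl⟩ := (PMF.mem_support_map_iff _ _ _).1 ha
    have hfloor : 2 ≤ ⌊γ⌋₊ := Nat.le_floor (by exact_mod_cast hγ)
    refine (hA _ ?_).feasible hw
    split_ifs
    exacts [hfloor.trans (Nat.floor_le_ceil γ), hfloor]
  rw [expectedQueries_roundRandomly]
  refine ENNReal.ofReal_le_ofReal ?_
  set queries : ℕ → ℝ := fun g => ((A g V I).run w).length
  have hγ2 : ((2 : ℕ) : ℝ) ≤ γ := by exact_mod_cast hγ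
  have hrobust : roundingMean γ queries ≤ γ * optCard I w :=
    (roundingMean_mono hγ2 fun g hg => (hA g hg).length_le_mul_optCard hg hw).trans_eq
      (roundingMean_natCast_mul (by linarith) _)
  have hconsistent : roundingMean γ queries ≤
      (1 + 1 / γ + roundingExcess γ) * (optCard I w + hopDistance I w) :=
    (roundingMean_mono hγ2 fun g hg =>
      (hA g hg).length_le_mul_optCard_add_hopDistance hg hw).trans_eq
      (roundingMean_one_add_inv_mul γ _)
  rcases (optCard I w).eq_zero_or_pos with h0 | hpos
  · simpa [h0] using hrobust
  have hpos' : (0 : ℝ) < optCard I w := by exact_mod_cast hpos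
  rw [min_mul_of_nonneg _ _ hpos'.le, mul_assoc, one_add_mul, div_mul_cancel₀ _ hpos'.ne']
  exact le_min hconsistent hrobust

end HypOrient

end

theorem theorem3p5 (γ : ℝ) (hγ : 2 ≤ γ) :
    ∃ ξ : ℝ, 0 ≤ ξ ∧ ξ ≤ 1 / 48 ∧
      ∃ A : ℕ → HypOrient.DetAlg.{u},
        (∀ g : ℕ, 2 ≤ g → HypOrient.Implements g (A g)) ∧
        (HypOrient.roundRandomly A γ).AchievesRatio (fun V _ I w =>
          min ((1 + 1 / γ + ξ) *
              (1 + (HypOrient.hopDistance I w : ℝ) / (HypOrient.optCard I w : ℝ))) γ) := by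
  obtain ⟨h0, h1⟩ := HypOrient.roundingExcess_mem hγ
  choose A hA using HypOrient.exists_implements.{u}
  exact ⟨HypOrient.roundingExcess γ, h0, h1, A, fun g _ => hA g,
    HypOrient.achievesRatio_roundRandomly hγ fun g _ => hA g⟩
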